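/- **Definitions.** A *generalized effect algebra* (GEA) is a set $E$ with an element $0$ and a partial binary operation $\oplus$ that is commutative and associative (if one side is defined, so is the other, and they are equal), with $e\oplus 0=e$, cancellation ($d\oplus e=d\oplus f\Rightarrow e=f$) and positivity ($e\oplus f=0\Rightarrow e=f=0$). Write $e\perp f$ if $e\oplus f$ is defined, and $e\le f$ if $e\oplus d=f$ for some $d$; this is a partial order, and such a $d$ is unique and written $f\ominus e$. Put $E[0,p]=\{e: e\le p\}$. A family is *orthogonal* if all its finite subfamilies have an orthosum, and *orthosummable*, with orthosum $s$, if moreover its finite partial orthosums have the supremum $s$. An *ideal* is a nonempty down-closed subset closed under existing orthosums. An ideal $S$ (for instance $S=E$) is the *direct sum* $S=H_1\oplus\dots\oplus H_n$ of ideals $H_i\subseteq S$ if any $h_i\in H_i$ $(1\le i\le n)$ form an orthogonal sequence and every $e\in S$ is uniquely $e=e_1\oplus\dots\oplus e_n$ with $e_i\in H_i$; an ideal $H$ is a *direct summand* of $E$ if $E=H\oplus K$ for some ideal $K$. The *exocenter* $\Gamma_{ex}(E)$ is the set of all maps $\pi\colon E\to E$ that preserve existing orthosums, are idempotent, satisfy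 $\pi e\le e$, and satisfy $e\perp f$ whenever $\pi e=e$ and $\pi f=0$. It is a Boolean algebra with $\pi\le\xi$ iff $\pi\circ\xi=\pi$, meet $\pi\wedge\xi=\pi\circ\xi$, complement $\pi' e=e\ominus\pi e$, zero map $0$ and identity $1$; $\pi$ and $\xi$ are *disjoint* if $\pi\wedge\xi=0$. A family $(e_i)$ is *$\Gamma_{ex}$-orthogonal* if there are pairwise disjoint $\pi_i\in\Gamma_{ex}(E)$ with $\pi_ie_i=e_i$. $E$ is *centrally orthocomplete* if every $\Gamma_{ex}$-orthogonal family is orthosummable and every element orthogonal to all its members is orthogonal to its orthosum; $E$ is *Dedekind orthocomplete* if every orthogonal family whose finite partial orthosums are bounded above is orthosummable. Let $\sim$ be an equivalence relation on $E$. Elements $e,f$ are *related* if there are nonzero $e_1\le e$, $f_1\le f$ with $e_1\sim f_1$, and *unrelated* otherwise; a subset $H$ is *hereditary* if $e\sim h_1\le h\in H$ implies $e\in H$; $\Sigma_\sim(E)$ is the set of all $\pi\in\Gamma_{ex}(E)$ such that $e\in\pi(E)$, $f\in\pi'(E)$, $e\sim f$ imply $e=f=0$. The relation $\sim$ is a *dimension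 equivalence relation* if * $e\sim0$ implies $e=0$; * if $(e_i)_{i\in I}$, $(f_i)_{i\in I}$ are orthosummable and $e_i\sim f_i$ for all $i$, then $\bigoplus e_i\sim\bigoplus f_i$; * if $p\sim s\oplus t$, then $p=e\oplus f$ with $e\sim s$, $f\sim t$; * if $e\oplus f=s\oplus t$, then $e=e_1\oplus e_2$, $f=f_1\oplus f_2$ with $s\sim e_1\oplus f_1$, $t\sim e_2\oplus f_2$; * if $e\not\perp f$, then $e$ and $f$ are related; * if $e\not\le f$, then there are nonzero $e_1,d_1$ with $e\ge e_1\sim d_1\perp f$; * if $e$ and $f$ are unrelated, there is $\pi\in\Sigma_\sim(E)$ with $e\in\pi(E)$, $f\in\pi'(E)$. A *dimension generalized effect algebra* (DGEA) is a centrally orthocomplete and Dedekind orthocomplete GEA with a dimension equivalence relation $\sim$. In a DGEA, $\eta_e$ denotes the smallest $\pi\in\Sigma_\sim(E)$ with $\pi e=e$, and $\Theta_\eta(E)=\{\eta_e:e\in E\}$; $p$ is *faithful* if $\eta_p=1$; $k$ is *simple* if every $e\le k$ is unrelated to $k\ominus e$; $f$ is *finite* if $e\le f$, $e\sim f$ imply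 $e=f$; $c$ is *invariant* if $e,f\le c$, $e\perp f$ imply $e\oplus f\le c$, and $c\ge c_1\sim f\perp c$ implies $c_1=f=0$. With $K$ and $F$ the sets of simple and of finite elements, $\eta_K=\bigvee_{k\in K}\eta_k$, $\eta_F=\bigvee_{f\in F}\eta_f$ (suprema in $\Gamma_{ex}(E)$), and $\tilde f$ is the largest finite invariant element. A DGEA is of *type I* if it has a faithful simple element; of *type II* if it has a faithful finite element but no nonzero simple element; of *type III* if it has no nonzero finite element; of type $\mathrm I_F$ (resp. $\mathrm{II}_F$) if it is of type I (resp. II) and has a faithful finite invariant element; of type $\mathrm I_{\neg F}$ (resp. $\mathrm{II}_{\neg F}$) if it is of type I (resp. II) and has no nonzero finite invariant element. For $\pi\in\Sigma_\sim(E)$ these notions are applied to $\pi(E)$ with the restrictions of $\oplus$ and $\sim$. **Theorem.** Let $E$ be a DGEA with dimension equivalence relation $\sim$. Then all $\eta_e$ $(e\in E)$, $\eta_K$, $\eta_F$ and $\tilde f$ exist, and the following hold. There are pairwise disjoint $\pi_{\mathrm I},\pi_{\mathrm{II}},\pi_{\mathrm{III}}\in\Sigma_\sim(E)$ with $\pi_{\mathrm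 I}\vee\pi_{\mathrm{II}}\vee\pi_{\mathrm{III}}=1$ such that $$E=\pi_{\mathrm I}(E)\oplus\pi_{\mathrm{II}}(E)\oplus\pi_{\mathrm{III}}(E),$$ where the three summands are hereditary direct summands of $E$ and DGEAs of types I, II and III, respectively. These mappings are unique: any $\rho_{\mathrm I},\rho_{\mathrm{II}},\rho_{\mathrm{III}}\in\Sigma_\sim(E)$ with join $1$ whose images are of types I, II, III, respectively, coincide with them; in fact $$\pi_{\mathrm I}=\eta_K\in\Theta_\eta(E),\qquad \pi_{\mathrm{II}}=\eta_F\wedge(\eta_K)'\in\Theta_\eta(E),\qquad \pi_{\mathrm{III}}=(\eta_F)'.$$ Moreover, there are pairwise disjoint $\pi_{\mathrm I_F},\pi_{\mathrm I_{\neg F}},\pi_{\mathrm{II}_F},\pi_{\mathrm{II}_{\neg F}}\in\Sigma_\sim(E)$ with $\pi_{\mathrm I_F}\vee\pi_{\mathrm I_{\neg F}}=\pi_{\mathrm I}$ and $\pi_{\mathrm{II}_F}\vee\pi_{\mathrm{II}_{\neg F}}=\pi_{\mathrm{II}}$ such that $$\pi_{\mathrm I}(E)=\pi_{\mathrm I_F}(E)\oplus\pi_{\mathrm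 I_{\neg F}}(E),\qquad \pi_{\mathrm{II}}(E)=\pi_{\mathrm{II}_F}(E)\oplus\pi_{\mathrm{II}_{\neg F}}(E),$$ where the four summands are hereditary direct summands of $E$ and DGEAs of types $\mathrm I_F$, $\mathrm I_{\neg F}$, $\mathrm{II}_F$, $\mathrm{II}_{\neg F}$, respectively. These mappings are unique as well (among quadruples in $\Sigma_\sim(E)$ with these joins and types); in fact $$\pi_{\mathrm I_F}=\eta_K\wedge\eta_{\tilde f},\quad \pi_{\mathrm I_{\neg F}}=\eta_K\wedge(\eta_{\tilde f})',\quad \pi_{\mathrm{II}_F}=\eta_F\wedge(\eta_K)'\wedge\eta_{\tilde f},\quad \pi_{\mathrm{II}_{\neg F}}=\eta_F\wedge(\eta_K)'\wedge(\eta_{\tilde f})',$$ and all four belong to $\Theta_\eta(E)$. Furthermore, $\pi_{\mathrm I_F}(E)$ and $\pi_{\mathrm{II}_F}(E)$ are effect algebras (i.e. have a largest element, the unit) with units $\eta_K\tilde f$ and $(\eta_K)'\tilde f$, respectively. -/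

import Mathlib

universe u v

/-- A generalized effect algebra. The partial operation `⊕` is given by its graph:
`IsSum e f g` says that `e ⊕ f` is defined and equal to `g`. -/
class GEA (E : Type u) extends Zero E where
  IsSum : E → E → E → Prop
  isSum_unique : ∀ {e f g h : E}, IsSum e f g → IsSum e f h → g = h
  comm : ∀ {e f g : E}, IsSum e f g → IsSum f e g
  assoc : ∀ {d e f s t : E}, IsSum e f s → IsSum d s t → ∃ r, IsSum d e r ∧ IsSum r f t
  add_zero : ∀ e : E, IsSum e 0 e
  cancel : ∀ {d e f s : E}, IsSum d e s → IsSum d f s → e = f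
  positive : ∀ {e f : E}, IsSum e f 0 → e = 0 ∧ f = 0

namespace GEA

section Basic

variable {E : Type u} [GEA E]

/-- `e ⊥ f`: the orthosum `e ⊕ f` is defined. -/
def Orth (e f : E) : Prop := ∃ g, IsSum e f g

theorem zero_isSum (e : E) : IsSum 0 e e := comm (add_zero e)

theorem assoc' {d e f r t : E} (h₁ : IsSum d e r) (h₂ : IsSum r f t) :
    ∃ s, IsSum e f s ∧ IsSum d s t := by
  obtain ⟨s, hs, ht⟩ := assoc (comm h₁) (comm h₂)
  exact ⟨s, comm hs, comm ht⟩

/-- The order of a generalized effect algebra: `e ≤ f` iff `e ⊕ d = f` for some `d`. -/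
instance instPartialOrder : PartialOrder E where
  le e f := ∃ d, IsSum e d f
  le_refl e := ⟨0, add_zero e⟩
  le_trans := by
    rintro a b c ⟨d, hd⟩ ⟨d', hd'⟩
    obtain ⟨s, -, h⟩ := assoc' hd hd'
    exact ⟨s, h⟩
  le_antisymm := by
    rintro a b ⟨d, hd⟩ ⟨d', hd'⟩
    obtain ⟨s, hs, h⟩ := assoc' hd hd'
    obtain rfl := cancel h (add_zero a)
    obtain ⟨rfl, -⟩ := positive hs
    exact isSum_unique (add_zero a) hd

theorem le_iff {e f : E} : e ≤ f ↔ ∃ d, IsSum e d f := Iff.rfl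

theorem IsSum.le {e f g : E} (h : IsSum e f g) : e ≤ g := ⟨f, h⟩

theorem zero_le' (e : E) : 0 ≤ e := ⟨e, zero_isSum e⟩

theorem eq_zero_of_le {e : E} (h : e ≤ 0) : e = 0 := le_antisymm h (zero_le' e)

theorem Orth.symm {e f : E} (h : Orth e f) : Orth f e := h.imp fun _ => comm

/-- `p` is principal: orthogonal elements below `p` have their orthosum below `p`. -/
def IsPrincipal (p : E) : Prop :=
  ∀ e f g : E, e ≤ p → f ≤ p → IsSum e f g → g ≤ p

/-- `IsFinSum e J s`: the finite subfamily `(e i)`, `i ∈ J`, is orthogonal with orthosum `s`. -/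
inductive IsFinSum {I : Type v} (e : I → E) : Finset I → E → Prop
  | empty : IsFinSum e ∅ 0
  | cons {J : Finset I} {i : I} (hi : i ∉ J) {s t : E} :
      IsFinSum e J s → IsSum s (e i) t → IsFinSum e (Finset.cons i J hi) t

/-- The family is orthogonal: every finite subfamily is. -/
def IsOrthogonal {I : Type v} (e : I → E) : Prop := ∀ J : Finset I, ∃ s, IsFinSum e J s

/-- The set of finite partial orthosums of a family. -/
def partialSums {I : Type v} (e : I → E) : Set E := {s | ∃ J : Finset I, IsFinSum e J s}

/-- The family is orthosummable, with orthosum `s`. -/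
def IsOrthosum {I : Type v} (e : I → E) (s : E) : Prop :=
  IsOrthogonal e ∧ IsLUB (partialSums e) s

/-- An ideal: a nonempty order ideal that is closed under existing orthosums. -/
structure IsIdeal (S : Set E) : Prop where
  nonempty : S.Nonempty
  lower : ∀ {s t : E}, s ∈ S → t ≤ s → t ∈ S
  sum : ∀ {s t r : E}, s ∈ S → t ∈ S → IsSum s t r → r ∈ S

/-- `S = H₁ ⊕ ⋯ ⊕ Hₙ`: the ideal `S` (for `S = univ`, the algebra itself) is the direct sum
of the ideals `Hᵢ ⊆ S`. -/
structure IsDirectSum (S : Set E) {n : ℕ} (H : Fin n → Set E) : Prop where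
  ideal : IsIdeal S
  ideals : ∀ i, IsIdeal (H i)
  subset : ∀ i, H i ⊆ S
  orthogonal : ∀ h : Fin n → E, (∀ i, h i ∈ H i) → IsOrthogonal h
  decompose : ∀ e ∈ S, ∃! h : Fin n → E, (∀ i, h i ∈ H i) ∧ IsFinSum h Finset.univ e

/-- `H` is a direct summand of `E`. -/
def IsDirectSummand (H : Set E) : Prop :=
  ∃ K : Set E, IsDirectSum Set.univ ![H, K]

end Basic

end GEA

open GEA in
/-- The exocenter of `E`: decreasing idempotent endomorphisms satisfying the
orthogonality condition. -/
@[ext]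
structure GEX (E : Type u) [GEA E] where
  toFun : E → E
  map_sum : ∀ {e f g : E}, IsSum e f g → IsSum (toFun e) (toFun f) (toFun g)
  idem : ∀ e : E, toFun (toFun e) = toFun e
  decreasing : ∀ e : E, toFun e ≤ e
  orth : ∀ {e f : E}, toFun e = e → toFun f = 0 → Orth e f

namespace GEX

open GEA

variable {E : Type u} [GEA E]

instance : CoeFun (GEX E) fun _ => E → E := ⟨GEX.toFun⟩

theorem map_zero (π : GEX E) : π 0 = 0 := eq_zero_of_le (π.decreasing 0)

theorem mono (π : GEX E) {e f : E} (h : e ≤ f) : π e ≤ π f := by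
  obtain ⟨d, hd⟩ := h
  exact (π.map_sum hd).le

/-- `π ≤ ξ` iff `π ∘ ξ = π`. -/
instance : PartialOrder (GEX E) where
  le π ξ := ∀ e, π (ξ e) = π e
  le_refl π := π.idem
  le_trans a b c hab hbc e := by rw [← hab (c e), hbc e, hab e]
  le_antisymm a b hab hba := by
    ext e
    refine le_antisymm ?_ ?_
    · rw [← hab e]; exact a.decreasing _
    · rw [← hba e]; exact b.decreasing _

/-- The largest element of the exocenter is the identity, the smallest the zero mapping. -/
instance : BoundedOrder (GEX E) where
  top :=
    { toFun := fun e => e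
      map_sum := fun h => h
      idem := fun _ => rfl
      decreasing := fun e => le_refl e
      orth := by rintro e f - rfl; exact ⟨e, add_zero e⟩ }
  le_top _ _ := rfl
  bot :=
    { toFun := fun _ => 0
      map_sum := fun _ => add_zero 0
      idem := fun _ => rfl
      decreasing := zero_le'
      orth := by rintro e f rfl -; exact ⟨f, zero_isSum f⟩ }
  bot_le _ _ := rfl

/-- `π' e = e ⊖ π e`. -/
noncomputable def complFun (π : GEX E) (e : E) : E := (le_iff.1 (π.decreasing e)).choose

theorem isSum_compl (π : GEX E) (e : E) : IsSum (π e) (π.complFun e) e :=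
  (le_iff.1 (π.decreasing e)).choose_spec

theorem complFun_eq (π : GEX E) {e d : E} (h : IsSum (π e) d e) : π.complFun e = d :=
  cancel (π.isSum_compl e) h

theorem apply_complFun (π : GEX E) (e : E) : π (π.complFun e) = 0 := by
  have h := π.map_sum (π.isSum_compl e)
  rw [π.idem] at h
  exact cancel h (add_zero _)

theorem apply_eq_zero (π : GEX E) {e : E} : π.complFun e = e → π e = 0 := fun h => by
  rw [← h]; exact π.apply_complFun e

theorem apply_eq_self (π : GEX E) {e : E} (h : π.complFun e = 0) : π e = e := by
  have := π.isSum_compl e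
  rw [h] at this
  exact isSum_unique (add_zero _) this

theorem apply_of_le (π : GEX E) {x y : E} (hy : π y = y) (hx : x ≤ y) : π x = x := by
  obtain ⟨d, hd⟩ := hx
  obtain ⟨z, hz, hz'⟩ := assoc' (comm (π.isSum_compl x)) hd
  have h := π.map_sum hz'
  rw [π.apply_complFun, hy] at h
  have hzy : π z = y := isSum_unique (zero_isSum _) h
  have hyz : y ≤ z := hzy ▸ π.decreasing z
  have hzy' : z = y := le_antisymm (comm hz').le hyz
  rw [hzy'] at hz'
  exact π.apply_eq_self (cancel (comm hz') (add_zero y))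

/-- The complement `π'` of `π` in the exocenter. -/
noncomputable instance : Compl (GEX E) where
  compl π :=
    { toFun := π.complFun
      map_sum := by
        intro e f g h
        obtain ⟨s, hs, hsg⟩ := assoc' (π.isSum_compl e) h
        obtain ⟨t, ht, hts⟩ := assoc (π.isSum_compl f) hs
        obtain ⟨w, hw, hws⟩ := assoc' (comm ht) hts
        obtain ⟨r, hr, hrg⟩ := assoc hws hsg
        obtain rfl := isSum_unique hr (π.map_sum h)
        rwa [π.complFun_eq hrg]
      idem := fun e => π.complFun_eq (by rw [π.apply_complFun]; exact zero_isSum _)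
      decreasing := fun e => ⟨_, comm (π.isSum_compl e)⟩
      orth := fun he hf => (π.orth (π.apply_eq_self hf) (π.apply_eq_zero he)).symm }

theorem comp_comm (π ξ : GEX E) (e : E) : π (ξ e) = ξ (π e) := by
  have h := π.map_sum (ξ.map_sum (π.isSum_compl e))
  rw [π.apply_of_le (π.idem e) (ξ.decreasing (π e))] at h
  have h0 : π (ξ (π.complFun e)) = 0 :=
    eq_zero_of_le (π.apply_complFun e ▸ π.mono (ξ.decreasing _))
  rw [h0] at h
  exact isSum_unique h (add_zero _)

/-- The infimum of `π` and `ξ` in the exocenter is their composition. -/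
instance : SemilatticeInf (GEX E) where
  inf π ξ :=
    { toFun := fun e => π (ξ e)
      map_sum := fun h => π.map_sum (ξ.map_sum h)
      idem := fun e => by rw [comp_comm ξ π, ξ.idem, π.idem]
      decreasing := fun e => (π.decreasing _).trans (ξ.decreasing e)
      orth := by
        intro e f he hf
        have hπ : π e = e := by
          conv_lhs => rw [← he]
          rw [π.idem, he]
        have hξ : ξ e = e := by
          conv_lhs => rw [← he]
          rw [comp_comm ξ π, ξ.idem, he]
        obtain ⟨s, hs⟩ := π.orth hπ hf
        have hsξ : ξ s = s := by
          have h := ξ.map_sum hs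
          rw [hξ, ξ.idem] at h
          exact isSum_unique h hs
        obtain ⟨t, ht⟩ := ξ.orth hsξ (ξ.apply_complFun f)
        obtain ⟨w, hw, hwt⟩ := assoc' hs ht
        rw [isSum_unique hw (ξ.isSum_compl f)] at hwt
        exact ⟨t, hwt⟩ }
  inf_le_left π ξ e := by
    change π (ξ (π e)) = π (ξ e)
    rw [comp_comm ξ π, π.idem]
  inf_le_right π ξ e := by
    change π (ξ (ξ e)) = π (ξ e)
    rw [ξ.idem]
  le_inf a b c hab hac e := by
    change a (b (c e)) = a e
    rw [hab, hac]

/-- The direct summand `π(E)` as a subset of `E`. -/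
def image (π : GEX E) : Set E := Set.range π.toFun

/-- The direct summand `π(E)` as a type of its own. -/
def Summand (π : GEX E) : Type u := {e : E // e ∈ π.image}

namespace Summand

variable {π : GEX E}

/-- The inclusion of `π(E)` in `E`. -/
def val (x : π.Summand) : E := Subtype.val x

theorem val_injective : Function.Injective (val : π.Summand → E) := Subtype.val_injective

theorem apply_val (x : π.Summand) : π x.val = x.val := by
  obtain ⟨y, hy⟩ := Subtype.property x
  rw [show x.val = π.toFun y from hy.symm]
  exact π.idem y

/-- An element `e` with `π e = e`, as an element of `π(E)`. -/
def mk (e : E) (h : π e = e) : π.Summand := ⟨e, e, h⟩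

/-- `π(E)` is a generalized effect algebra under the restriction of `⊕`. -/
instance : GEA π.Summand where
  zero := mk 0 π.map_zero
  IsSum x y z := IsSum x.val y.val z.val
  isSum_unique h₁ h₂ := val_injective (isSum_unique h₁ h₂)
  comm h := comm h
  assoc := by
    intro d e f s t h₁ h₂
    obtain ⟨r, hr, hrt⟩ := assoc h₁ h₂
    have h : π r = r := π.apply_of_le (apply_val t) hrt.le
    exact ⟨mk r h, hr, hrt⟩
  add_zero x := add_zero x.val
  cancel h₁ h₂ := val_injective (cancel h₁ h₂)
  positive h := ⟨val_injective (positive h).1, val_injective (positive h).2⟩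

end Summand

/-- The restriction of a relation on `E` to the direct summand `π(E)`. -/
def restrict (π : GEX E) (sim : E → E → Prop) (x y : π.Summand) : Prop := sim x.val y.val

end GEX

namespace GEA

section Dimension

variable {E : Type u} [GEA E]

/-- `GEX`-orthogonality of a family. -/
def IsGEXOrthogonal {I : Type v} (e : I → E) : Prop :=
  ∃ p : I → GEX E, Pairwise (fun i j => p i ⊓ p j = ⊥) ∧ ∀ i, p i (e i) = e i

/-- Central orthocompleteness. -/
structure IsCentrallyOrthocomplete (E : Type u) [GEA E] : Prop where
  summable : ∀ (I : Type u) (e : I → E), IsGEXOrthogonal e → ∃ s, IsOrthosum e s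
  orth_sum : ∀ (I : Type u) (e : I → E) (s f : E), IsGEXOrthogonal e → IsOrthosum e s →
    (∀ i, Orth f (e i)) → Orth f s

/-- Dedekind orthocompleteness. -/
def IsDedekindOrthocomplete (E : Type u) [GEA E] : Prop :=
  ∀ (I : Type u) (e : I → E), IsOrthogonal e → BddAbove (partialSums e) → ∃ s, IsOrthosum e s

/-- `e` and `f` are related: they have nonzero equivalent subelements. -/
def Related (sim : E → E → Prop) (e f : E) : Prop :=
  ∃ e₁ f₁ : E, e₁ ≠ 0 ∧ f₁ ≠ 0 ∧ e₁ ≤ e ∧ sim e₁ f₁ ∧ f₁ ≤ f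

/-- Sherstnev-Kalinin congruences. -/
structure IsSKCongruence (sim : E → E → Prop) : Prop where
  equivalence : Equivalence sim
  sk1 : ∀ e : E, sim e 0 → e = 0
  sk2 : ∀ (I : Type u) (e f : I → E) (s t : E), IsOrthosum e s → IsOrthosum f t →
    (∀ i, sim (e i) (f i)) → sim s t
  sk3d : ∀ p s t r : E, IsSum s t r → sim p r → ∃ e f, IsSum e f p ∧ sim e s ∧ sim f t
  sk3e : ∀ e f s t r : E, IsSum e f r → IsSum s t r →
    ∃ e₁ e₂ f₁ f₂ a b, IsSum e₁ e₂ e ∧ IsSum f₁ f₂ f ∧ IsSum e₁ f₁ a ∧ sim s a ∧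
      IsSum e₂ f₂ b ∧ sim t b
  sk4a : ∀ e f : E, ¬ Orth e f → Related sim e f
  sk4b : ∀ e f : E, ¬ e ≤ f → ∃ e₁ d₁ : E, e₁ ≠ 0 ∧ d₁ ≠ 0 ∧ e₁ ≤ e ∧ sim e₁ d₁ ∧ Orth d₁ f

/-- The set `Σ_∼(E)` of all `π` in the exocenter that split `∼`. -/
def splitting (sim : E → E → Prop) : Set (GEX E) :=
  {π | ∀ e f : E, e ∈ π.image → f ∈ (πᶜ).image → sim e f → e = 0 ∧ f = 0}

/-- Dimension equivalence relations. -/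
structure IsDER (sim : E → E → Prop) : Prop extends IsSKCongruence sim where
  sk4a' : ∀ e f : E, ¬ Related sim e f → ∃ π ∈ splitting sim, e ∈ π.image ∧ f ∈ (πᶜ).image

/-- `E` with the relation `∼` is a dimension generalized effect algebra. -/
structure IsDGEA (sim : E → E → Prop) : Prop where
  centrallyOrthocomplete : IsCentrallyOrthocomplete E
  dedekindOrthocomplete : IsDedekindOrthocomplete E
  der : IsDER sim

/-- A subset is hereditary: it contains every element sub-equivalent to one of its members. -/
def IsHereditary (sim : E → E → Prop) (H : Set E) : Prop :=
  ∀ h ∈ H, ∀ e h₁ : E, sim e h₁ → h₁ ≤ h → e ∈ H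

/-- `θ = η_e`: the smallest mapping in `Σ_∼(E)` that fixes `e`. -/
def IsHull (sim : E → E → Prop) (e : E) (θ : GEX E) : Prop :=
  IsLeast {ξ : GEX E | ξ ∈ splitting sim ∧ ξ e = e} θ

open Classical in
/-- The hull system `η_e`. (A smallest mapping exists in a dimension generalized effect
algebra; the value `⊤` is a placeholder where there is none.) -/
noncomputable def hull (sim : E → E → Prop) (e : E) : GEX E :=
  if h : ∃ θ, IsHull sim e θ then h.choose else ⊤

/-- The `η`-exocenter `Θ_η(E)`. -/
def etaExocenter (sim : E → E → Prop) : Set (GEX E) := {θ | ∃ e : E, IsHull sim e θ}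

/-- `p` is faithful: `η_p = 1`. -/
def IsFaithful (sim : E → E → Prop) (p : E) : Prop := IsHull sim p ⊤

/-- The set `K` of simple elements: every subelement is unrelated to its complement. -/
def simples (sim : E → E → Prop) : Set E :=
  {k | ∀ e d : E, IsSum e d k → ¬ Related sim e d}

/-- The set `F` of finite elements. -/
def finites (sim : E → E → Prop) : Set E :=
  {f | ∀ e : E, e ≤ f → sim e f → e = f}

/-- The set `Γ_∼(E)` of invariant elements. -/
def invariants (sim : E → E → Prop) : Set E :=
  {c | IsPrincipal c ∧ ∀ c₁ f : E, c₁ ≤ c → sim c₁ f → Orth f c → c₁ = 0 ∧ f = 0}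

open Classical in
/-- The supremum `⋁ η_t`, `t ∈ T`, in the exocenter (a placeholder where it does not exist). -/
noncomputable def hullSup (sim : E → E → Prop) (T : Set E) : GEX E :=
  if h : ∃ θ, IsLUB (hull sim '' T) θ then h.choose else ⊤

/-- `η_K`. -/
noncomputable def etaK (sim : E → E → Prop) : GEX E := hullSup sim (simples sim)

/-- `η_F`. -/
noncomputable def etaF (sim : E → E → Prop) : GEX E := hullSup sim (finites sim)

open Classical in
/-- The largest finite invariant element (a placeholder where there is none). -/
noncomputable def fTilde (sim : E → E → Prop) : E :=
  if h : ∃ f, IsGreatest (finites sim ∩ invariants sim) f then h.choose else 0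

/-- Type I: there is a faithful simple element. -/
def IsTypeI (sim : E → E → Prop) : Prop := ∃ k ∈ simples sim, IsFaithful sim k

/-- Type II: there is a faithful finite element, but no nonzero simple element. -/
def IsTypeII (sim : E → E → Prop) : Prop :=
  (∃ f ∈ finites sim, IsFaithful sim f) ∧ ∀ k ∈ simples sim, k = 0

/-- Type III: there is no nonzero finite element. -/
def IsTypeIII (sim : E → E → Prop) : Prop := ∀ f ∈ finites sim, f = 0

/-- Finite type: there is a faithful finite invariant element. -/
def IsFiniteType (sim : E → E → Prop) : Prop :=
  ∃ f ∈ finites sim ∩ invariants sim, IsFaithful sim f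

/-- Properly non-finite type: there is no nonzero finite invariant element. -/
def IsProperlyNonFiniteType (sim : E → E → Prop) : Prop :=
  ∀ f ∈ finites sim ∩ invariants sim, f = 0

/-- Type I_F. -/
def IsTypeIF (sim : E → E → Prop) : Prop := IsTypeI sim ∧ IsFiniteType sim

/-- Type I_{¬F}. -/
def IsTypeINF (sim : E → E → Prop) : Prop := IsTypeI sim ∧ IsProperlyNonFiniteType sim

/-- Type II_F. -/
def IsTypeIIF (sim : E → E → Prop) : Prop := IsTypeII sim ∧ IsFiniteType sim

/-- Type II_{¬F}. -/
def IsTypeIINF (sim : E → E → Prop) : Prop := IsTypeII sim ∧ IsProperlyNonFiniteType sim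

/-- `π(E)` is a hereditary direct summand of `E`, and it is a dimension generalized effect
algebra under the restriction of `∼`. -/
structure IsHereditarySummand (sim : E → E → Prop) (π : GEX E) : Prop where
  directSummand : IsDirectSummand π.image
  hereditary : IsHereditary sim π.image
  dgea : IsDGEA (π.restrict sim)

/-- `E` is an effect algebra with unit `u`: `u` is the largest element. -/
def IsEffectAlgebraWithUnit (u : E) : Prop := IsTop u

end Dimension

end GEA

/-! ### Finite and infinite orthosums. -/

namespace GEA

section Basic

variable {E : Type u} [GEA E]

/-! The exocenter is a Boolean algebra, and central orthocompleteness gives it suprema of disjoint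
families, acting pointwise by orthosums (`GEX.exists_disjoint_sup`). A mapping lies in Σ_∼ exactly
when it preserves ∼ (`sim_apply`, `mem_splitting_of_sim_apply`); hence Σ_∼ is a Boolean subalgebra,
and a Zorn argument closes it under arbitrary suprema (`exists_isLUB_splitting`). So η_e exists, as
the complement of the join of all splitting mappings that kill e, and η_{πe} = π ∧ η_e
(`hull_apply`).

The central step is `exists_mem_hull_le`: a class of elements stable under splitting mappings and
under orthosums with disjoint hulls has a member with the largest hull, namely the orthosum of a
maximal family with disjoint hulls. Simple, finite, and finite invariant elements form such classes,
because these properties can be tested on the components of an orthosum. Thus η_K and η_F are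
themselves hulls, of one simple and one finite element. Since c is invariant iff it is the top of
η_c(E) (`mem_invariants_iff`), the finite invariant element with the largest hull is the largest
one, f̃.

For π in Σ_∼, the type of π(E) then becomes an inequality: type I means π ≤ η_K, type II π ≤ η_F ∧
η_K', type III π ≤ η_F', finite type π ≤ η_f̃, properly non-finite type π ≤ η_f̃'. The first three
bounds partition 1, and the last two split each part further. Taking π equal to the bounds gives
existence. Uniqueness holds because mappings below disjoint bounds, with the same join as the
bounds, must equal them. -/

theorem eq_of_isSum_zero {e g : E} (h : IsSum e 0 g) : g = e := isSum_unique h (add_zero e)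

theorem eq_of_zero_isSum {e g : E} (h : IsSum 0 e g) : g = e := isSum_unique h (zero_isSum e)

theorem IsSum.le_right {e f g : E} (h : IsSum e f g) : f ≤ g := (comm h).le

theorem IsSum.exists_mono_left {e e₁ f g : E} (h : IsSum e f g) (he : e₁ ≤ e) :
    ∃ g₁, IsSum e₁ f g₁ ∧ g₁ ≤ g := by
  obtain ⟨d, hd⟩ := he
  obtain ⟨s, hs, hsg⟩ := assoc' (comm hd) h
  exact ⟨s, hs, hsg.le_right⟩

theorem IsSum.exists_mono {e e₁ f f₁ g : E} (h : IsSum e f g) (he : e₁ ≤ e) (hf : f₁ ≤ f) :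
    ∃ g₁, IsSum e₁ f₁ g₁ ∧ g₁ ≤ g := by
  obtain ⟨a, ha, hag⟩ := h.exists_mono_left he
  obtain ⟨b, hb, hba⟩ := (comm ha).exists_mono_left hf
  exact ⟨b, comm hb, hba.trans hag⟩

theorem IsSum.mono {e e₁ f f₁ g g₁ : E} (h : IsSum e f g) (h₁ : IsSum e₁ f₁ g₁) (he : e₁ ≤ e)
    (hf : f₁ ≤ f) : g₁ ≤ g := by
  obtain ⟨a, ha, hag⟩ := h.exists_mono he hf
  exact isSum_unique h₁ ha ▸ hag

theorem Orth.mono {e e₁ f f₁ : E} (h : Orth e f) (he : e₁ ≤ e) (hf : f₁ ≤ f) : Orth e₁ f₁ := by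
  obtain ⟨g, hg⟩ := h
  obtain ⟨a, ha, -⟩ := hg.exists_mono he hf
  exact ⟨a, ha⟩

/-- `IsFinSum` builds a sum in some order of the indices; commutativity and associativity let any
chosen index come last. Uniqueness of finite orthosums rests on this. -/
theorem IsFinSum.erase {I : Type v} [DecidableEq I] {e : I → E} {J : Finset I} {s : E}
    (h : IsFinSum e J s) {i : I} (hi : i ∈ J) :
    ∃ r, IsFinSum e (J.erase i) r ∧ IsSum r (e i) s := by
  induction h with
  | empty => simp at hi
  | @cons J j hj s t hs hst ih =>
    by_cases hij : i = j
    · subst hij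
      refine ⟨s, ?_, hst⟩
      simpa [Finset.cons_eq_insert, Finset.erase_insert hj] using hs
    · obtain ⟨r, hr, hrs⟩ := ih (by simpa [hij] using hi)
      obtain ⟨w, hw, hwt⟩ := assoc' hrs hst
      obtain ⟨r', hr', hrt⟩ := assoc (comm hw) hwt
      refine ⟨r', ?_, hrt⟩
      have hj' : j ∉ J.erase i := fun h => hj (Finset.mem_of_mem_erase h)
      have : (Finset.cons j J hj).erase i = Finset.cons j (J.erase i) hj' := by
        ext x
        simp only [Finset.mem_erase, Finset.mem_cons]
        grind
      rw [this]
      exact hr.cons hj' hr'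

theorem IsFinSum.unique {I : Type v} {e : I → E} {J : Finset I} {s t : E}
    (hs : IsFinSum e J s) (ht : IsFinSum e J t) : s = t := by
  classical
  induction hs generalizing t with
  | empty =>
    generalize hK : (∅ : Finset I) = K at ht
    cases ht with
    | empty => rfl
    | cons hi _ _ => exact absurd hK.symm (Finset.cons_ne_empty hi)
  | @cons J i hi s u _ hsu ih =>
    obtain ⟨r, hr, hrt⟩ := ht.erase (Finset.mem_cons_self i J)
    have hJ : (Finset.cons i J hi).erase i = J := by
      rw [Finset.cons_eq_insert, Finset.erase_insert hi]
    rw [hJ] at hr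
    obtain rfl := ih hr
    exact isSum_unique hsu hrt

theorem IsFinSum.exists_subset {I : Type v} {e : I → E} {K : Finset I} {t : E}
    (h : IsFinSum e K t) : ∀ J ⊆ K, ∃ s ≤ t, IsFinSum e J s := by
  classical
  induction h with
  | empty =>
    intro J hJ
    rw [Finset.subset_empty.1 hJ]
    exact ⟨0, le_rfl, .empty⟩
  | @cons K i hi s t hs hst ih =>
    intro J hJ
    by_cases hiJ : i ∈ J
    · obtain ⟨a, ha, haJ⟩ := ih (J.erase i) (by
        intro x hx
        have := hJ (Finset.mem_of_mem_erase hx)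
        simpa [Finset.ne_of_mem_erase hx] using this)
      obtain ⟨b, hb, hbt⟩ := hst.exists_mono_left ha
      refine ⟨b, hbt, ?_⟩
      have := haJ.cons (Finset.notMem_erase i J) hb
      rwa [Finset.cons_eq_insert, Finset.insert_erase hiJ] at this
    · obtain ⟨a, ha, haJ⟩ := ih J (by
        intro x hx
        have hxi : x ≠ i := fun h => hiJ (h ▸ hx)
        simpa [hxi] using hJ hx)
      exact ⟨a, ha.trans hst.le, haJ⟩

theorem IsFinSum.le_of_le {I : Type v} {e f : I → E} {J : Finset I} {s t : E}
    (hs : IsFinSum e J s) (ht : IsFinSum f J t) (h : ∀ i, e i ≤ f i) : s ≤ t := by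
  classical
  induction hs generalizing t with
  | empty => exact zero_le' t
  | @cons J i hi s u _ hsu ih =>
    obtain ⟨r, hr, hrt⟩ := ht.erase (Finset.mem_cons_self i J)
    have hJ : (Finset.cons i J hi).erase i = J := by
      rw [Finset.cons_eq_insert, Finset.erase_insert hi]
    rw [hJ] at hr
    exact hrt.mono hsu (ih hr) (h i)

theorem IsFinSum.eq_zero {I : Type v} {e : I → E} {J : Finset I} {s : E}
    (hs : IsFinSum e J s) (h : ∀ i ∈ J, e i = 0) : s = 0 := by
  induction hs with
  | empty => rfl
  | @cons J i hi s t _ hst ih =>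
    rw [h i (Finset.mem_cons_self i J), ih fun j hj => h j (Finset.mem_cons_of_mem hj)] at hst
    exact eq_of_isSum_zero hst

/-- Only an inequality, since `i` need not belong to `J`. -/
theorem IsFinSum.le_single {I : Type v} {e : I → E} {J : Finset I} {s : E} (i : I)
    (hs : IsFinSum e J s) (h : ∀ j, j ≠ i → e j = 0) : s ≤ e i := by
  induction hs with
  | empty => exact zero_le' _
  | @cons J j hj s t hs hst ih =>
    by_cases hji : j = i
    · subst hji
      rw [hs.eq_zero fun k hk => h k fun hkj => hj (hkj ▸ hk)] at hst
      exact (eq_of_zero_isSum hst).le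
    · rw [h j hji] at hst
      exact eq_of_isSum_zero hst ▸ ih

theorem IsFinSum.apply_le {I : Type v} {e : I → E} {J : Finset I} {s : E}
    (hs : IsFinSum e J s) {i : I} (hi : i ∈ J) : e i ≤ s := by
  classical
  obtain ⟨r, -, hr⟩ := hs.erase hi
  exact hr.le_right

theorem isFinSum_singleton {I : Type v} (e : I → E) (i : I) : IsFinSum e {i} (e i) :=
  IsFinSum.empty.cons (Finset.notMem_empty i) (zero_isSum _)

theorem isOrthosum_of_isFinSum {I : Type v} [Fintype I] {e : I → E} {s : E}
    (h : IsFinSum e Finset.univ s) : IsOrthosum e s := by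
  refine ⟨fun J => ?_, ?_, fun u hu => hu ⟨_, h⟩⟩
  · obtain ⟨t, -, ht⟩ := h.exists_subset J (Finset.subset_univ J)
    exact ⟨t, ht⟩
  · rintro t ⟨J, hJ⟩
    obtain ⟨t', ht', h'⟩ := h.exists_subset J (Finset.subset_univ J)
    exact hJ.unique h' ▸ ht'

theorem IsOrthosum.unique {I : Type v} {e : I → E} {s t : E} (hs : IsOrthosum e s)
    (ht : IsOrthosum e t) : s = t := hs.2.unique ht.2

theorem IsOrthosum.apply_le {I : Type v} {e : I → E} {s : E} (h : IsOrthosum e s) (i : I) :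
    e i ≤ s := h.2.1 ⟨{i}, isFinSum_singleton e i⟩

theorem IsOrthosum.eq_zero {I : Type v} {e : I → E} {s : E} (hs : IsOrthosum e s)
    (h : ∀ i, e i = 0) : s = 0 :=
  eq_zero_of_le <| hs.2.2 <| by
    rintro t ⟨J, hJ⟩
    exact (hJ.eq_zero fun i _ => h i).le

theorem IsOrthosum.le_of_le {I : Type v} {e f : I → E} {s t : E} (hs : IsOrthosum e s)
    (ht : IsOrthosum f t) (h : ∀ i, e i ≤ f i) : s ≤ t :=
  hs.2.2 <| by
    rintro a ⟨J, hJ⟩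
    obtain ⟨b, hb⟩ := ht.1 J
    exact (hJ.le_of_le hb h).trans (ht.2.1 ⟨J, hb⟩)

/-- Turns a binary sum into a family. `ULift` adjusts the universe of the index type, as `sk2`
speaks of index types in the universe of `E`. -/
theorem isOrthosum_cond {e f g : E} (h : IsSum e f g) :
    IsOrthosum (fun b : ULift.{v} Bool => cond b.down e f) g := by
  apply isOrthosum_of_isFinSum
  have h₁ := (isFinSum_singleton (fun b : ULift.{v} Bool => cond b.down e f) ⟨true⟩).cons
    (i := ⟨false⟩) (by simp) h
  convert h₁
  ext ⟨b⟩
  cases b <;> simp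

/-- If the finite partial orthosums of two families add up to those of a third one, then so do
the orthosums. -/
theorem IsOrthosum.isSum {I : Type v} {e f g : I → E} {r s t : E} (hr : IsOrthosum e r)
    (hs : IsOrthosum f s) (ht : IsOrthosum g t)
    (hrs : ∀ J a b c, IsFinSum e J a → IsFinSum f J b → IsFinSum g J c → IsSum a b c) :
    IsSum r s t := by
  classical
  -- Partial sums over different index sets are compared inside `J ∪ K`, where the sums of the two
  -- families do add up.
  have key : ∀ J K a b, IsFinSum e J a → IsFinSum f K b → ∃ c ≤ t, IsSum a b c := by
    intro J K a b ha hb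
    obtain ⟨a', ha'⟩ := hr.1 (J ∪ K)
    obtain ⟨b', hb'⟩ := hs.1 (J ∪ K)
    obtain ⟨c', hc'⟩ := ht.1 (J ∪ K)
    obtain ⟨a₁, ha₁, h₁⟩ := ha'.exists_subset J Finset.subset_union_left
    obtain ⟨b₁, hb₁, h₂⟩ := hb'.exists_subset K Finset.subset_union_right
    obtain rfl := ha.unique h₁
    obtain rfl := hb.unique h₂
    obtain ⟨c, hc, hc₁⟩ := (hrs _ _ _ _ ha' hb' hc').exists_mono ha₁ hb₁
    exact ⟨c, hc₁.trans (ht.2.1 ⟨_, hc'⟩), hc⟩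
  -- For fixed `b`, the difference t ⊖ b bounds every partial sum `a`, hence also their supremum
  -- `r`. The same argument then replaces `b` by `s`.
  have key₂ : ∀ K b, IsFinSum f K b → ∃ c ≤ t, IsSum r b c := by
    intro K b hb
    obtain ⟨d, hd⟩ : b ≤ t := by
      obtain ⟨c, hc, hbc⟩ := key ∅ K 0 b .empty hb
      exact hbc.le_right.trans hc
    have : r ≤ d := hr.2.2 <| by
      rintro a ⟨J, ha⟩
      obtain ⟨c, ⟨x, hx⟩, hac⟩ := key J K a b ha hb
      obtain ⟨y, hy, hyt⟩ := assoc' (comm hac) hx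
      obtain rfl := cancel hyt hd
      exact hy.le
    obtain ⟨c, hc, hct⟩ := (comm hd).exists_mono_left this
    exact ⟨c, hct, hc⟩
  obtain ⟨d, hd⟩ : r ≤ t := by
    obtain ⟨c, hc, hrc⟩ := key₂ ∅ 0 .empty
    exact hrc.le.trans hc
  have hsd : s ≤ d := hs.2.2 <| by
    rintro b ⟨K, hb⟩
    obtain ⟨c, ⟨x, hx⟩, hac⟩ := key₂ K b hb
    obtain ⟨y, hy, hyt⟩ := assoc' hac hx
    obtain rfl := cancel hyt hd
    exact hy.le
  obtain ⟨c, hc, hct⟩ := (comm hd).exists_mono_left hsd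
  have htc : t ≤ c := ht.2.2 <| by
    rintro z ⟨J, hz⟩
    obtain ⟨a, ha⟩ := hr.1 J
    obtain ⟨b, hb⟩ := hs.1 J
    exact (comm hc).mono (hrs _ _ _ _ ha hb hz) (hr.2.1 ⟨J, ha⟩) (hs.2.1 ⟨J, hb⟩)
  exact le_antisymm hct htc ▸ comm hc

end Basic

end GEA

/-! ### The exocenter as a Boolean algebra, and finite direct sums. -/

namespace GEX

open GEA

variable {E : Type u} [GEA E]

theorem map_isFinSum (π : GEX E) {I : Type v} {e : I → E} {J : Finset I} {s : E}
    (h : IsFinSum e J s) : IsFinSum (fun i => π (e i)) J (π s) := by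
  induction h with
  | empty => rw [π.map_zero]; exact .empty
  | cons hi _ hst ih => exact ih.cons hi (π.map_sum hst)

theorem isSum_apply_compl (π : GEX E) (e : E) : IsSum (π e) (πᶜ e) e := π.isSum_compl e

theorem compl_apply_eq (π : GEX E) {e d : E} (h : IsSum (π e) d e) : πᶜ e = d :=
  π.complFun_eq h

theorem apply_compl (π : GEX E) (e : E) : π (πᶜ e) = 0 := π.apply_complFun e

theorem compl_eq_zero_iff (π : GEX E) {e : E} : πᶜ e = 0 ↔ π e = e :=
  ⟨π.apply_eq_self, fun h => π.compl_apply_eq (by rw [h]; exact add_zero e)⟩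

theorem compl_eq_self_iff (π : GEX E) {e : E} : πᶜ e = e ↔ π e = 0 :=
  ⟨π.apply_eq_zero, fun h => π.compl_apply_eq (by rw [h]; exact zero_isSum e)⟩

theorem mem_image (π : GEX E) {e : E} : e ∈ π.image ↔ π e = e :=
  ⟨by rintro ⟨x, rfl⟩; exact π.idem x, fun h => ⟨e, h⟩⟩

theorem inf_apply (π ξ : GEX E) (e : E) : (π ⊓ ξ) e = π (ξ e) := rfl

theorem bot_apply (e : E) : (⊥ : GEX E) e = 0 := rfl

theorem apply_eq_self_of_le {π ξ : GEX E} (h : π ≤ ξ) {e : E} (he : π e = e) : ξ e = e := by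
  rw [← he, ← comp_comm, h e]

/-- Apply `π` to e = ξe ⊕ ξ'e: the second term vanishes. This turns inequalities into disjointness
statements before any Boolean structure is available. -/
theorem le_of_inf_compl {π ξ : GEX E} (h : π ⊓ ξᶜ = ⊥) : π ≤ ξ := fun e => by
  have h₁ := π.map_sum (ξ.isSum_apply_compl e)
  have h₂ : π (ξᶜ e) = 0 := congrArg (fun σ : GEX E => σ e) h
  rw [h₂] at h₁
  exact (eq_of_isSum_zero h₁).symm

theorem compl_compl_eq (π : GEX E) : πᶜᶜ = π := by
  ext e
  exact πᶜ.compl_apply_eq (comm (π.isSum_apply_compl e))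

theorem inf_compl_eq_bot (π : GEX E) : π ⊓ πᶜ = ⊥ := by
  ext e
  exact π.apply_compl e

theorem inf_compl_of_le {π ξ : GEX E} (h : π ≤ ξ) : π ⊓ ξᶜ = ⊥ := by
  ext e
  change π (ξᶜ e) = 0
  rw [← h, ξ.apply_compl, π.map_zero]

theorem compl_antitone {π ξ : GEX E} (h : π ≤ ξ) : ξᶜ ≤ πᶜ :=
  le_of_inf_compl (by rw [compl_compl_eq, inf_comm]; exact inf_compl_of_le h)

/-- Both sides complete πξe to πe. This identity is what makes the lattice distributive. -/
theorem inf_compl_inf (π ξ : GEX E) : π ⊓ (π ⊓ ξ)ᶜ = π ⊓ ξᶜ := by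
  ext e
  change π ((π ⊓ ξ)ᶜ e) = π (ξᶜ e)
  rw [comp_comm]
  refine (π ⊓ ξ).compl_apply_eq ?_
  change IsSum (π (ξ (π e))) _ _
  rw [← comp_comm π ξ e, π.idem]
  exact π.map_sum (ξ.isSum_apply_compl e)

/-- The exocenter is a lattice. -/
@[reducible]
noncomputable def lattice : Lattice (GEX E) where
  sup π ξ := (πᶜ ⊓ ξᶜ)ᶜ
  le_sup_left π ξ := by
    have := compl_antitone (inf_le_left : πᶜ ⊓ ξᶜ ≤ πᶜ)
    rwa [compl_compl_eq] at this
  le_sup_right π ξ := by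
    have := compl_antitone (inf_le_right : πᶜ ⊓ ξᶜ ≤ ξᶜ)
    rwa [compl_compl_eq] at this
  sup_le π ξ σ h₁ h₂ := by
    have := compl_antitone (le_inf (compl_antitone h₁) (compl_antitone h₂))
    rwa [compl_compl_eq σ] at this

attribute [local instance] lattice

theorem compl_sup_eq (π ξ : GEX E) : (π ⊔ ξ)ᶜ = πᶜ ⊓ ξᶜ := compl_compl_eq _

/-- The exocenter is a distributive lattice. -/
@[reducible]
noncomputable def distribLattice : DistribLattice (GEX E) :=
  DistribLattice.ofInfSupLe fun a b c => le_of_inf_compl <| by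
    -- By `inf_compl_inf`, meeting `a` with the complements of `a ⊓ b` and `a ⊓ c` leaves a ∧ (b ∨
    -- c)', which is disjoint from b ∨ c.
    rw [compl_sup_eq]
    have h : a ⊓ ((a ⊓ b)ᶜ ⊓ (a ⊓ c)ᶜ) = a ⊓ (b ⊔ c)ᶜ := by
      rw [← inf_assoc, inf_compl_inf, inf_right_comm, inf_compl_inf, inf_assoc, compl_sup_eq,
        inf_comm cᶜ]
    rw [inf_right_comm, h, inf_assoc, inf_comm (b ⊔ c)ᶜ, inf_compl_eq_bot, inf_bot_eq]

attribute [local instance] distribLattice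

/-- The exocenter is a Boolean algebra. -/
@[reducible]
noncomputable def booleanAlgebra : BooleanAlgebra (GEX E) where
  inf_compl_le_bot π := (inf_compl_eq_bot π).le
  top_le_sup_compl π := le_of_inf_compl <| by
    rw [compl_sup_eq, compl_compl_eq, inf_comm πᶜ, inf_compl_eq_bot, inf_bot_eq]
  le_top _ := le_top
  bot_le _ := bot_le

attribute [local instance] booleanAlgebra

theorem isSum_sup_apply {π ξ : GEX E} (h : π ⊓ ξ = ⊥) (e : E) :
    IsSum (π e) (ξ e) ((π ⊔ ξ) e) := by
  have h₁ := π.isSum_apply_compl ((π ⊔ ξ) e)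
  rw [← inf_apply, ← inf_apply, inf_sup_self, inf_sup_left, inf_comm πᶜ π, inf_compl_eq_bot,
    bot_sup_eq] at h₁
  have h₂ : πᶜ ⊓ ξ = ξ := inf_eq_right.2 (le_compl_iff_disjoint_left.2 (disjoint_iff.2 h))
  rwa [h₂] at h₁

theorem apply_eq_self_of_isSum (π : GEX E) {e f g : E} (h : IsSum e f g) (he : π e = e)
    (hf : π f = f) : π g = g := by
  have := π.map_sum h
  rw [he, hf] at this
  exact isSum_unique this h

theorem inf_finset_sup_eq_bot {I : Type v} {p : I → GEX E}
    (hp : Pairwise fun i j => p i ⊓ p j = ⊥) {J : Finset I} {i : I} (hi : i ∉ J) :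
    J.sup p ⊓ p i = ⊥ := by
  rw [← disjoint_iff, Finset.disjoint_sup_left]
  exact fun j hj => disjoint_iff.2 (hp fun h => hi (h ▸ hj))

theorem isFinSum_apply {I : Type v} {p : I → GEX E} (hp : Pairwise fun i j => p i ⊓ p j = ⊥)
    (e : E) (J : Finset I) : IsFinSum (fun i => p i e) J ((J.sup p) e) := by
  induction J using Finset.cons_induction with
  | empty => exact .empty
  | cons i J hi ih =>
    refine ih.cons hi ?_
    rw [Finset.sup_cons, sup_comm]
    exact isSum_sup_apply (inf_finset_sup_eq_bot hp hi) e

/-- By induction, a partial sum over `J` is fixed by the join of the `p j`, while this join kills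
the next term; the orthogonality axiom of the exocenter lets that term be added. -/
theorem isOrthogonal_of_disjoint {I : Type v} {p : I → GEX E}
    (hp : Pairwise fun i j => p i ⊓ p j = ⊥) {e : I → E} (he : ∀ i, p i (e i) = e i) :
    IsOrthogonal e := by
  suffices h : ∀ J : Finset I, ∃ s, IsFinSum e J s ∧ (J.sup p) s = s from
    fun J => (h J).imp fun _ => And.left
  intro J
  induction J using Finset.cons_induction with
  | empty => exact ⟨0, .empty, rfl⟩
  | cons i J hi ih =>
    obtain ⟨s, hs, hps⟩ := ih
    have h0 : (J.sup p) (e i) = 0 := by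
      rw [← he i, ← inf_apply, inf_finset_sup_eq_bot hp hi, bot_apply]
    obtain ⟨t, ht⟩ := (J.sup p).orth hps h0
    refine ⟨t, hs.cons hi ht, ?_⟩
    rw [Finset.sup_cons]
    exact apply_eq_self_of_isSum _ ht (apply_eq_self_of_le le_sup_right hps)
      (apply_eq_self_of_le le_sup_left (he i))

theorem isIdeal_image (π : GEX E) : IsIdeal π.image where
  nonempty := ⟨0, 0, π.map_zero⟩
  lower hs ht := π.mem_image.2 (π.apply_of_le (π.mem_image.1 hs) ht)
  sum hs ht h := π.mem_image.2 (π.apply_eq_self_of_isSum h (π.mem_image.1 hs) (π.mem_image.1 ht))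

theorem isDirectSum_image {n : ℕ} {p : Fin n → GEX E} (hp : Pairwise fun i j => p i ⊓ p j = ⊥)
    {π : GEX E} (hπ : Finset.univ.sup p = π) :
    IsDirectSum π.image fun i => (p i).image where
  ideal := π.isIdeal_image
  ideals i := (p i).isIdeal_image
  subset i e he := π.mem_image.2 <|
    apply_eq_self_of_le (hπ ▸ Finset.le_sup (Finset.mem_univ i)) ((p i).mem_image.1 he)
  orthogonal h hh := isOrthogonal_of_disjoint hp fun i => (p i).mem_image.1 (hh i)
  decompose e he := by
    refine ⟨fun i => p i e, ⟨fun i => ⟨e, rfl⟩, ?_⟩, ?_⟩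
    · have := isFinSum_apply hp e Finset.univ
      rwa [hπ, π.mem_image.1 he] at this
    -- Applying `p i` to any such decomposition kills all terms except `h i`, so the components are
    -- forced.
    · rintro h ⟨hh, hs⟩
      funext i
      refine le_antisymm ?_ ?_
      · rw [← (p i).mem_image.1 (hh i)]
        exact (p i).mono (hs.apply_le (Finset.mem_univ i))
      · conv_rhs => rw [← (p i).mem_image.1 (hh i)]
        refine ((p i).map_isFinSum hs).le_single i fun j hj => ?_
        rw [← (p j).mem_image.1 (hh j), ← inf_apply, hp hj.symm, bot_apply]

end GEX

/-! ### Maximal disjoint families and infinite suprema in the exocenter. -/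

theorem exists_maximal_pairwise {α : Type u} (r : α → α → Prop) (hr : ∀ {a b}, r a b → r b a)
    (P : Set α) : ∃ T ⊆ P, T.Pairwise r ∧ ∀ a ∈ P, (∀ b ∈ T, a ≠ b → r a b) → a ∈ T := by
  obtain ⟨T, hT⟩ := zorn_subset {T : Set α | T ⊆ P ∧ T.Pairwise r} (by
    intro c hc hchain
    refine ⟨⋃₀ c, ⟨Set.sUnion_subset fun t ht => (hc ht).1, ?_⟩,
      fun t ht => Set.subset_sUnion_of_mem ht⟩
    exact (Set.pairwise_sUnion hchain.directedOn).2 fun t ht => (hc ht).2)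
  refine ⟨T, hT.prop.1, hT.prop.2, fun a ha h => ?_⟩
  have : insert a T ∈ {T : Set α | T ⊆ P ∧ T.Pairwise r} :=
    ⟨Set.insert_subset ha hT.prop.1, hT.prop.2.insert fun b hb hab => ⟨h b hb hab, hr (h b hb hab)⟩⟩
  exact hT.le_of_ge this (Set.subset_insert a T) (Set.mem_insert a T)

section

attribute [local instance] GEX.lattice GEX.distribLattice GEX.booleanAlgebra

namespace GEX

open GEA

variable {E : Type u} [GEA E]

/-- The element u = x_i ⊕ p_i's lies below `s`, yet bounds every partial sum, because `p i` maps a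
partial sum below `x i`. Hence u = s, and cancellation identifies p_i s. -/
theorem apply_isOrthosum {I : Type v} {p : I → GEX E} (hp : Pairwise fun i j => p i ⊓ p j = ⊥)
    {x : I → E} {s : E} (hx : ∀ i, p i (x i) = x i) (hs : IsOrthosum x s) (i : I) :
    p i s = x i := by
  have hle : x i ≤ p i s := hx i ▸ (p i).mono (hs.apply_le i)
  obtain ⟨u, hu, hus⟩ := ((p i).isSum_apply_compl s).exists_mono_left hle
  have hsu : s ≤ u := hs.2.2 <| by
    rintro t ⟨J, hJ⟩
    refine hu.mono ((p i).isSum_apply_compl t) ?_ ((p i)ᶜ.mono (hs.2.1 ⟨J, hJ⟩))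
    rw [← hx i]
    refine ((p i).map_isFinSum hJ).le_single i fun j hj => ?_
    rw [← hx j, ← inf_apply, hp hj.symm, bot_apply]
  rw [le_antisymm hus hsu] at hu
  exact cancel (comm ((p i).isSum_apply_compl s)) (comm hu)

/-- A disjoint family has a supremum, which acts by forming orthosums. -/
theorem exists_disjoint_sup (hE : IsCentrallyOrthocomplete E) {I : Type u} {p : I → GEX E}
    (hp : Pairwise fun i j => p i ⊓ p j = ⊥) :
    ∃ σ : GEX E, (∀ e, IsOrthosum (fun i => p i e) (σ e)) ∧ IsLUB (Set.range p) σ := by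
  have hx : ∀ e, ∃ s, IsOrthosum (fun i => p i e) s := fun e =>
    hE.summable I _ ⟨p, hp, fun i => (p i).idem e⟩
  choose σ hσ using hx
  have hpσ : ∀ i e, p i (σ e) = p i e := fun i e =>
    apply_isOrthosum hp (fun i => (p i).idem e) (hσ e) i
  let τ : GEX E :=
    { toFun := σ
      map_sum := fun {e f g} h => (hσ e).isSum (hσ f) (hσ g) fun J a b c ha hb hc => by
        rw [ha.unique (isFinSum_apply hp e J), hb.unique (isFinSum_apply hp f J),
          hc.unique (isFinSum_apply hp g J)]
        exact (J.sup p).map_sum h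
      idem := fun e => by
        have h := hσ (σ e)
        simp only [hpσ] at h
        exact h.unique (hσ e)
      decreasing := fun e => (hσ e).2.2 <| by
        rintro t ⟨J, hJ⟩
        rw [hJ.unique (isFinSum_apply hp e J)]
        exact (J.sup p).decreasing e
      -- Every component p_i e is orthogonal to `f`, since p_i f = p_i σf = 0. The second half of
      -- central orthocompleteness passes this on to the orthosum `e`.
      orth := fun {e f} he hf => by
        refine (hE.orth_sum I _ e f ⟨p, hp, fun i => (p i).idem e⟩
          (by have := hσ e; rwa [he] at this) fun i => ?_).symm
        refine ((p i).orth ((p i).idem e) ?_).symm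
        rw [← hpσ, hf, (p i).map_zero] }
  refine ⟨τ, hσ, ?_, fun ξ hξ e => ?_⟩
  · rintro _ ⟨i, rfl⟩
    exact hpσ i
  · have h : ∀ i, p i (ξ e) = p i e := fun i => hξ ⟨i, rfl⟩ e
    have h₁ := hσ (ξ e)
    simp only [h] at h₁
    exact h₁.unique (hσ e)

theorem isOrthosum_apply {I : Type u} (hE : IsCentrallyOrthocomplete E) {p : I → GEX E}
    (hp : Pairwise fun i j => p i ⊓ p j = ⊥) {ρ : GEX E} (hρ : IsLUB (Set.range p) ρ) {e : E}
    (he : ρ e = e) : IsOrthosum (fun i => p i e) e := by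
  obtain ⟨σ, hσ, hlub⟩ := exists_disjoint_sup hE hp
  have := hσ e
  rwa [hlub.unique hρ, he] at this

end GEX

/-! ### Splitting mappings and hulls. -/

namespace GEA

open GEX

variable {E : Type u} [GEA E] {sim : E → E → Prop}

theorem mem_splitting {π : GEX E} :
    π ∈ splitting sim ↔ ∀ e f, π e = e → π f = 0 → sim e f → e = 0 ∧ f = 0 := by
  have : ∀ f, f ∈ (πᶜ).image ↔ π f = 0 := fun f => by
    rw [← π.compl_eq_self_iff]; exact πᶜ.mem_image
  simp only [splitting, Set.mem_ofPred_eq, π.mem_image, this]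

theorem compl_mem_splitting (h : IsSKCongruence sim) {π : GEX E} (hπ : π ∈ splitting sim) :
    πᶜ ∈ splitting sim := by
  rw [mem_splitting] at hπ ⊢
  intro e f he hf hef
  exact (hπ f e (π.compl_eq_zero_iff.1 hf) (π.compl_eq_self_iff.1 he)
    (h.equivalence.symm hef)).symm

/-- Transport f = πf ⊕ π'f to `e` along ∼. The part of `e` equivalent to π'f lies in π(E), so
splitting forces π'f = 0. -/
theorem apply_eq_self_of_sim (h : IsSKCongruence sim) {π : GEX E} (hπ : π ∈ splitting sim)
    {e f : E} (hef : sim e f) (he : π e = e) : π f = f := by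
  rw [mem_splitting] at hπ
  obtain ⟨a, b, hab, -, hb⟩ := h.sk3d e _ _ f (π.isSum_apply_compl f) hef
  exact π.compl_eq_zero_iff.1
    (hπ b (πᶜ f) (π.apply_of_le he hab.le_right) (π.apply_compl f) hb).2

/-- Together with `mem_splitting_of_sim_apply` this characterises Σ_∼ as the mappings preserving ∼,
a condition that passes to compositions and to pointwise orthosums. -/
theorem sim_apply (h : IsSKCongruence sim) {π : GEX E} (hπ : π ∈ splitting sim)
    {e f : E} (hef : sim e f) : sim (π e) (π f) := by
  obtain ⟨a, b, hab, ha, hb⟩ := h.sk3d f _ _ e (π.isSum_apply_compl e) (h.equivalence.symm hef)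
  have ha' : π a = a := apply_eq_self_of_sim h hπ (h.equivalence.symm ha) (π.idem e)
  have hb' : πᶜ b = b := apply_eq_self_of_sim h (compl_mem_splitting h hπ)
    (h.equivalence.symm hb) (πᶜ.idem e)
  have h₁ := π.map_sum hab
  rw [ha', π.compl_eq_self_iff.1 hb'] at h₁
  rw [eq_of_isSum_zero h₁]
  exact h.equivalence.symm ha

theorem eq_zero_of_sim (h : IsSKCongruence sim) {e : E} (he : sim 0 e) : e = 0 :=
  h.sk1 e (h.equivalence.symm he)

theorem mem_splitting_of_sim_apply (h : IsSKCongruence sim) {π : GEX E}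
    (hπ : ∀ e f, sim e f → sim (π e) (π f)) : π ∈ splitting sim := by
  rw [mem_splitting]
  intro e f he hf hef
  have h₁ := hπ e f hef
  rw [he, hf] at h₁
  obtain rfl := h.sk1 e h₁
  exact ⟨rfl, eq_zero_of_sim h hef⟩

theorem inf_mem_splitting (h : IsSKCongruence sim) {π ξ : GEX E} (hπ : π ∈ splitting sim)
    (hξ : ξ ∈ splitting sim) : π ⊓ ξ ∈ splitting sim :=
  mem_splitting_of_sim_apply h fun _ _ hef => sim_apply h hπ (sim_apply h hξ hef)

theorem sup_mem_splitting (h : IsSKCongruence sim) {π ξ : GEX E} (hπ : π ∈ splitting sim)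
    (hξ : ξ ∈ splitting sim) : π ⊔ ξ ∈ splitting sim := by
  rw [← compl_compl (π ⊔ ξ), compl_sup]
  exact compl_mem_splitting h
    (inf_mem_splitting h (compl_mem_splitting h hπ) (compl_mem_splitting h hξ))

theorem top_mem_splitting (h : IsSKCongruence sim) : (⊤ : GEX E) ∈ splitting sim :=
  mem_splitting_of_sim_apply h fun _ _ hef => hef

theorem sim_sum (h : IsSKCongruence sim) {e f g e₁ f₁ g₁ : E} (hg : IsSum e f g)
    (hg₁ : IsSum e₁ f₁ g₁) (he : sim e e₁) (hf : sim f f₁) : sim g g₁ :=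
  h.sk2 _ _ _ _ _ (isOrthosum_cond hg) (isOrthosum_cond hg₁) (by
    rintro ⟨b⟩
    cases b
    exacts [hf, he])

/-- Every set of splitting mappings has a supremum, which is a splitting mapping. -/
theorem exists_isLUB_splitting (hE : IsDGEA sim) {S : Set (GEX E)} (hS : S ⊆ splitting sim) :
    ∃ σ ∈ splitting sim, IsLUB S σ ∧ ∀ e, (∀ s ∈ S, s e = 0) → σ e = 0 := by
  have h := hE.der.toIsSKCongruence
  -- `T` is a maximal disjoint family of splitting mappings, each below some member of `S`; the
  -- supremum of `T` will be that of `S`.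
  obtain ⟨T, hTP, hT, hmax⟩ := exists_maximal_pairwise (fun π ξ : GEX E => π ⊓ ξ = ⊥)
    (fun {a b} hab => inf_comm a b ▸ hab) {ξ | ξ ∈ splitting sim ∧ ∃ s ∈ S, ξ ≤ s}
  have hp : Pairwise fun i j : T => i.1 ⊓ j.1 = ⊥ := fun i j hij =>
    hT i.2 j.2 fun h => hij (Subtype.ext h)
  obtain ⟨σ, hσ, hlub⟩ := exists_disjoint_sup hE.centrallyOrthocomplete hp
  have hσs : σ ∈ splitting sim := mem_splitting_of_sim_apply h fun e f hef =>
    h.sk2 _ _ _ _ _ (hσ e) (hσ f) fun i => sim_apply h (hTP i.2).1 hef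
  refine ⟨σ, hσs, ⟨fun s hs => ?_, fun ξ hξ => hlub.2 ?_⟩, fun e he => (hσ e).eq_zero fun i => ?_⟩
  -- The part of `s` outside `σ` is disjoint from every member of `T`, so it belongs to `T` by
  -- maximality. It is then below `σ` as well, hence zero.
  · have hmem : s ⊓ σᶜ ∈ T := by
      refine hmax _ ⟨inf_mem_splitting h (hS hs) (compl_mem_splitting h hσs), s, hs,
        inf_le_left⟩ fun b hb _ => ?_
      rw [← disjoint_iff]
      exact (disjoint_compl_left.mono_left inf_le_right).mono_right (hlub.1 ⟨⟨b, hb⟩, rfl⟩)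
    have hle : s ⊓ σᶜ ≤ σ := hlub.1 ⟨⟨_, hmem⟩, rfl⟩
    refine GEX.le_of_inf_compl (le_bot_iff.1 ?_)
    rw [← GEX.inf_compl_eq_bot σ]
    exact le_inf hle inf_le_right
  · rintro _ ⟨i, rfl⟩
    obtain ⟨s, hs, his⟩ := (hTP i.2).2
    exact his.trans (hξ hs)
  · obtain ⟨s, hs, his⟩ := (hTP i.2).2
    rw [← his e, he s hs, GEX.map_zero]

theorem isHull_hull (hE : IsDGEA sim) (e : E) : IsHull sim e (hull sim e) := by
  have h := hE.der.toIsSKCongruence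
  suffices hex : ∃ θ, IsHull sim e θ by
    rw [hull, dif_pos hex]
    exact hex.choose_spec
  -- `σ` is the largest splitting mapping that kills `e`: pointwise vanishing survives the supremum.
  -- Its complement is the hull.
  obtain ⟨σ, hσ, hlub, hzero⟩ := exists_isLUB_splitting hE
    (S := {ξ | ξ ∈ splitting sim ∧ ξ e = 0}) fun _ hξ => hξ.1
  refine ⟨σᶜ, ⟨compl_mem_splitting h hσ, ?_⟩, fun ξ ⟨hξ, hξe⟩ => ?_⟩
  · exact σ.compl_eq_self_iff.2 (hzero e fun s hs => hs.2)
  · exact compl_le_of_compl_le (hlub.1 ⟨compl_mem_splitting h hξ, ξ.compl_eq_zero_iff.2 hξe⟩)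

theorem IsHull.eq_hull (hE : IsDGEA sim) {e : E} {θ : GEX E} (h : IsHull sim e θ) :
    hull sim e = θ := (isHull_hull hE e).unique h

theorem hull_mem_splitting (hE : IsDGEA sim) (e : E) : hull sim e ∈ splitting sim :=
  (isHull_hull hE e).1.1

theorem hull_apply_self (hE : IsDGEA sim) (e : E) : hull sim e e = e := (isHull_hull hE e).1.2

theorem hull_le_iff (hE : IsDGEA sim) {e : E} {ξ : GEX E} (hξ : ξ ∈ splitting sim) :
    hull sim e ≤ ξ ↔ ξ e = e :=
  ⟨fun h => apply_eq_self_of_le h (hull_apply_self hE e), fun h => (isHull_hull hE e).2 ⟨hξ, h⟩⟩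

theorem hull_mono (hE : IsDGEA sim) {e f : E} (h : e ≤ f) : hull sim e ≤ hull sim f :=
  (hull_le_iff hE (hull_mem_splitting hE f)).2 ((hull sim f).apply_of_le (hull_apply_self hE f) h)

/-- From e = πe ⊕ π'e one gets η_e ≤ η_{πe} ∨ π'; meeting with `π` gives the harder inequality. In
particular every splitting mapping below a hull is itself a hull. -/
theorem hull_apply (hE : IsDGEA sim) {π : GEX E} (hπ : π ∈ splitting sim) (e : E) :
    hull sim (π e) = π ⊓ hull sim e := by
  have h := hE.der.toIsSKCongruence
  have hs := hull_mem_splitting hE (π e)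
  apply le_antisymm
  · rw [hull_le_iff hE (inf_mem_splitting h hπ (hull_mem_splitting hE e)), inf_apply,
      (hull sim e).apply_of_le (hull_apply_self hE e) (π.decreasing e), π.idem]
  · have hle : hull sim e ≤ hull sim (π e) ⊔ πᶜ := by
      rw [hull_le_iff hE (sup_mem_splitting h hs (compl_mem_splitting h hπ))]
      exact apply_eq_self_of_isSum _ (π.isSum_apply_compl e)
        (apply_eq_self_of_le le_sup_left (hull_apply_self hE _))
        (apply_eq_self_of_le le_sup_right (πᶜ.idem e))
    refine (inf_le_inf_left π hle).trans ?_
    rw [inf_sup_left, GEX.inf_compl_eq_bot, sup_bot_eq]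
    exact inf_le_right

end GEA

/-! ### Simple, finite and invariant elements with largest hull. -/

namespace GEA

open GEX

variable {E : Type u} [GEA E] {sim : E → E → Prop}

/-- A set of elements that is stable under splitting mappings and under orthosums of families
with disjoint hulls contains an element with the largest hull. -/
theorem exists_mem_hull_le (hE : IsDGEA sim) {P : Set E}
    (hdown : ∀ e ∈ P, ∀ π ∈ splitting sim, π e ∈ P)
    (hsum : ∀ (I : Type u) (x : I → E) (s : E),
      (Pairwise fun i j => hull sim (x i) ⊓ hull sim (x j) = ⊥) →
      (∀ i, x i ∈ P) → IsOrthosum x s → s ∈ P) :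
    ∃ s ∈ P, ∀ e ∈ P, hull sim e ≤ hull sim s := by
  obtain ⟨T, hTP, hT, hmax⟩ := exists_maximal_pairwise
    (fun a b : E => hull sim a ⊓ hull sim b = ⊥) (fun {a b} hab => inf_comm (hull sim a) _ ▸ hab) P
  have hp : Pairwise fun i j : T => hull sim i.1 ⊓ hull sim j.1 = ⊥ := fun i j hij =>
    hT i.2 j.2 fun h => hij (Subtype.ext h)
  obtain ⟨s, hs⟩ := hE.centrallyOrthocomplete.summable T Subtype.val
    ⟨_, hp, fun i => hull_apply_self hE i.1⟩
  have hsc := compl_mem_splitting hE.der.toIsSKCongruence (hull_mem_splitting hE s)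
  refine ⟨s, hsum T _ s hp (fun i => hTP i.2) hs, fun e he => ?_⟩
  -- The part of `e` outside η_s has hull disjoint from those of all members of `T`, so it lies in
  -- `T`. It is then below `s` and fixed by η_s, which forces it to vanish.
  have hd : (hull sim s)ᶜ e ∈ T := hmax _ (hdown e he _ hsc) fun b hb _ => by
    rw [hull_apply hE hsc, ← disjoint_iff]
    exact (disjoint_compl_left.mono_left inf_le_left).mono_right
      (hull_mono hE (hs.apply_le ⟨b, hb⟩))
  rw [hull_le_iff hE (hull_mem_splitting hE s), ← GEX.compl_eq_zero_iff]
  have hfix := (hull sim s).apply_of_le (hull_apply_self hE s) (hs.apply_le ⟨_, hd⟩)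
  exact hfix.symm.trans (GEX.apply_compl _ e)

section Orthosum

variable {I : Type u} {x : I → E} {s : E}

theorem hull_apply_orthosum (hE : IsDGEA sim)
    (hp : Pairwise fun i j => hull sim (x i) ⊓ hull sim (x j) = ⊥) (hs : IsOrthosum x s) (i : I) :
    hull sim (x i) s = x i :=
  GEX.apply_isOrthosum hp (fun i => hull_apply_self hE (x i)) hs i

/-- The join of the hulls of the `x i` fixes every partial sum, hence `s`, and so dominates η_s.
Elements of η_s(E) can therefore be studied componentwise. -/
theorem isOrthosum_hull_apply (hE : IsDGEA sim)
    (hp : Pairwise fun i j => hull sim (x i) ⊓ hull sim (x j) = ⊥) (hs : IsOrthosum x s) {e : E}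
    (he : hull sim s e = e) : IsOrthosum (fun i => hull sim (x i) e) e := by
  obtain ⟨σ, hσ, hlub, -⟩ := exists_isLUB_splitting hE
    (S := Set.range fun i => hull sim (x i)) (by rintro _ ⟨i, rfl⟩; exact hull_mem_splitting hE _)
  refine GEX.isOrthosum_apply hE.centrallyOrthocomplete hp hlub (apply_eq_self_of_le ?_ he)
  rw [hull_le_iff hE hσ]
  refine le_antisymm (σ.decreasing s) (hs.2.2 ?_)
  rintro t ⟨J, hJ⟩
  have hx : ∀ i, σ (x i) = x i := fun i =>
    apply_eq_self_of_le (hlub.1 ⟨i, rfl⟩) (hull_apply_self hE (x i))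
  have h := σ.map_isFinSum hJ
  simp only [hx] at h
  rw [hJ.unique h]
  exact σ.mono (hs.2.1 ⟨J, hJ⟩)

end Orthosum

theorem Related.mono {e e₁ f f₁ : E} (h : Related sim e₁ f₁) (he : e₁ ≤ e) (hf : f₁ ≤ f) :
    Related sim e f := by
  obtain ⟨a, b, ha, hb, hae, hab, hbf⟩ := h
  exact ⟨a, b, ha, hb, hae.trans he, hab, hbf.trans hf⟩

theorem mem_simples_of_le {k l : E} (hk : k ∈ simples sim) (hl : l ≤ k) : l ∈ simples sim := by
  intro e d hed hr
  obtain ⟨r, hr'⟩ := hl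
  obtain ⟨t, ht, htk⟩ := assoc' hed hr'
  exact hk e t htk (hr.mono le_rfl ht.le)

theorem mem_finites_of_le (hE : IsDGEA sim) {f g : E} (hf : f ∈ finites sim) (hg : g ≤ f) :
    g ∈ finites sim := by
  intro e he hge
  obtain ⟨x, hx⟩ := hg
  obtain ⟨y, hy, hyf⟩ := hx.exists_mono_left he
  have := hf y hyf (sim_sum hE.der.toIsSKCongruence hy hx hge (hE.der.equivalence.refl x))
  subst this
  exact cancel (comm hy) (comm hx)

/-- If k = e ⊕ d and e ∼ k, then `e` contains a copy of `d`. Simplicity forbids this unless `d` is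
zero. -/
theorem simples_subset_finites (hE : IsDGEA sim) : simples sim ⊆ finites sim := by
  intro k hk e he hke
  obtain ⟨d, hd⟩ := he
  obtain ⟨a, b, hab, -, hb⟩ := hE.der.sk3d e e d k hd hke
  by_contra hne
  refine hk e d hd ⟨b, d, ?_, ?_, hab.le_right, hb, le_rfl⟩
  · rintro rfl
    rw [eq_zero_of_sim hE.der.toIsSKCongruence hb] at hd
    exact hne (eq_of_isSum_zero hd).symm
  · rintro rfl
    exact hne (eq_of_isSum_zero hd).symm

theorem exists_simple_hull_le (hE : IsDGEA sim) :
    ∃ k ∈ simples sim, ∀ e ∈ simples sim, hull sim e ≤ hull sim k := by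
  have h := hE.der.toIsSKCongruence
  refine exists_mem_hull_le hE (fun e he π _ => mem_simples_of_le he (π.decreasing e)) ?_
  rintro I x s hp hx hs e d hed ⟨e₁, d₁, he₁, -, hee, hsim, hdd⟩
  have hes : hull sim s e₁ = e₁ :=
    (hull sim s).apply_of_le (hull_apply_self hE s) (hee.trans hed.le)
  -- Some component of `e₁` is nonzero. Since hull mappings preserve ∼, that component would make
  -- two complementary parts of `x i` related.
  obtain ⟨i, hi⟩ : ∃ i, hull sim (x i) e₁ ≠ 0 := by
    by_contra! hcon
    exact he₁ ((isOrthosum_hull_apply hE hp hs hes).eq_zero hcon)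
  have hsum := (hull sim (x i)).map_sum hed
  rw [hull_apply_orthosum hE hp hs i] at hsum
  have hsim' := sim_apply h (hull_mem_splitting hE (x i)) hsim
  refine hx i _ _ hsum ⟨_, _, hi, fun h0 => hi ?_, (hull sim (x i)).mono hee, hsim',
    (hull sim (x i)).mono hdd⟩
  rw [h0] at hsim'
  exact h.sk1 _ hsim'

theorem orthosum_mem_finites (hE : IsDGEA sim) {I : Type u} {x : I → E} {s : E}
    (hp : Pairwise fun i j => hull sim (x i) ⊓ hull sim (x j) = ⊥)
    (hx : ∀ i, x i ∈ finites sim) (hs : IsOrthosum x s) : s ∈ finites sim := by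
  have h := hE.der.toIsSKCongruence
  intro e he hse
  have hes : hull sim s e = e := (hull sim s).apply_of_le (hull_apply_self hE s) he
  have h₁ := isOrthosum_hull_apply hE hp hs hes
  have h₂ : ∀ i, hull sim (x i) e = x i := fun i => by
    have hle := (hull sim (x i)).mono he
    have hsim := sim_apply h (hull_mem_splitting hE (x i)) hse
    rw [hull_apply_orthosum hE hp hs i] at hle hsim
    exact hx i _ hle hsim
  simp only [h₂] at h₁
  exact h₁.unique hs

theorem exists_finite_hull_le (hE : IsDGEA sim) :
    ∃ f ∈ finites sim, ∀ e ∈ finites sim, hull sim e ≤ hull sim f :=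
  exists_mem_hull_le hE (fun e he π _ => mem_finites_of_le hE he (π.decreasing e))
    fun _ _ _ hp hx hs => orthosum_mem_finites hE hp hx hs

/-- An element is invariant iff it is the largest element of the range of its hull mapping. -/
theorem mem_invariants_iff (hE : IsDGEA sim) {c : E} :
    c ∈ invariants sim ↔ ∀ e, hull sim c e = e → e ≤ c := by
  have h := hE.der.toIsSKCongruence
  have hc := hull_mem_splitting hE c
  constructor
  · rintro ⟨-, hinv⟩ e he
    by_contra hle
    obtain ⟨e₁, d₁, he₁, -, hee, hsim, hd⟩ := hE.der.sk4b e c hle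
    -- Invariance makes `c` unrelated to the orthogonal element `d₁`, so a splitting mapping
    -- separates them and η_c kills `d₁`. But η_c fixes `e₁`, and e₁ ∼ d₁.
    have hun : ¬ Related sim c d₁ := by
      rintro ⟨a, b, ha, -, hac, hab, hbd⟩
      exact ha (hinv a b hac hab (hd.mono hbd le_rfl)).1
    obtain ⟨π, hπ, hπc, hπd⟩ := hE.der.sk4a' c d₁ hun
    have hle := (hull_le_iff hE hπ).2 (π.mem_image.1 hπc)
    have hd₀ : hull sim c d₁ = 0 := by
      rw [← hle d₁, π.compl_eq_self_iff.1 (πᶜ.mem_image.1 hπd), GEX.map_zero]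
    have hs := sim_apply h hc hsim
    rw [hd₀, (hull sim c).apply_of_le he hee] at hs
    exact he₁ (h.sk1 _ hs)
  · intro hmax
    have hself := hull_apply_self hE c
    refine ⟨fun e f g he hf hg => hmax g ?_, fun c₁ f hc₁ hsim hf => ?_⟩
    · exact apply_eq_self_of_isSum _ hg ((hull sim c).apply_of_le hself he)
        ((hull sim c).apply_of_le hself hf)
    · have hff : hull sim c f = f :=
        apply_eq_self_of_sim h hc hsim ((hull sim c).apply_of_le hself hc₁)
      obtain ⟨g, hg⟩ := hf
      have hgc := hmax g (apply_eq_self_of_isSum _ hg hff hself)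
      rw [le_antisymm hgc hg.le_right] at hg
      obtain rfl := cancel (comm hg) (add_zero c)
      exact ⟨h.sk1 _ hsim, rfl⟩

theorem apply_mem_invariants (hE : IsDGEA sim) {c : E} (hc : c ∈ invariants sim) {π : GEX E}
    (hπ : π ∈ splitting sim) : π c ∈ invariants sim := by
  rw [mem_invariants_iff hE] at hc ⊢
  intro e he
  rw [hull_apply hE hπ] at he
  have h₁ := π.mono (hc e (apply_eq_self_of_le inf_le_right he))
  rwa [apply_eq_self_of_le inf_le_left he] at h₁

theorem exists_isGreatest_finite_invariant (hE : IsDGEA sim) :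
    ∃ f, IsGreatest (finites sim ∩ invariants sim) f := by
  obtain ⟨s, hs, hmax⟩ := exists_mem_hull_le hE (P := finites sim ∩ invariants sim)
    (fun e he π hπ => ⟨mem_finites_of_le hE he.1 (π.decreasing e),
      apply_mem_invariants hE he.2 hπ⟩) (by
      intro I x s hp hx hs
      refine ⟨orthosum_mem_finites hE hp (fun i => (hx i).1) hs, ?_⟩
      rw [mem_invariants_iff hE]
      intro e he
      exact (isOrthosum_hull_apply hE hp hs he).le_of_le hs fun i =>
        (mem_invariants_iff hE).1 (hx i).2 _ (GEX.idem _ e))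
  -- For an invariant `s`, largest hull implies largest element: every competitor lies in η_s(E),
  -- whose top is `s`.
  exact ⟨s, hs, fun c hc => (mem_invariants_iff hE).1 hs.2 c <|
    apply_eq_self_of_le (hmax c hc) (hull_apply_self hE c)⟩

theorem isGreatest_fTilde (hE : IsDGEA sim) :
    IsGreatest (finites sim ∩ invariants sim) (fTilde sim) := by
  have hex := exists_isGreatest_finite_invariant hE
  rw [fTilde, dif_pos hex]
  exact hex.choose_spec

theorem isLUB_hullSup (hE : IsDGEA sim) (T : Set E) : IsLUB (hull sim '' T) (hullSup sim T) := by
  have hex : ∃ θ, IsLUB (hull sim '' T) θ := by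
    obtain ⟨σ, -, hσ, -⟩ := exists_isLUB_splitting hE (S := hull sim '' T)
      (by rintro _ ⟨e, -, rfl⟩; exact hull_mem_splitting hE e)
    exact ⟨σ, hσ⟩
  rw [hullSup, dif_pos hex]
  exact hex.choose_spec

theorem exists_simple_hull_eq (hE : IsDGEA sim) : ∃ k ∈ simples sim, hull sim k = etaK sim := by
  obtain ⟨k, hk, hmax⟩ := exists_simple_hull_le hE
  refine ⟨k, hk, IsLUB.unique (s := hull sim '' _) ⟨?_, fun ξ hξ => hξ ⟨k, hk, rfl⟩⟩
    (isLUB_hullSup hE _)⟩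
  rintro _ ⟨e, he, rfl⟩
  exact hmax e he

theorem exists_finite_hull_eq (hE : IsDGEA sim) : ∃ f ∈ finites sim, hull sim f = etaF sim := by
  obtain ⟨f, hf, hmax⟩ := exists_finite_hull_le hE
  refine ⟨f, hf, IsLUB.unique (s := hull sim '' _) ⟨?_, fun ξ hξ => hξ ⟨f, hf, rfl⟩⟩
    (isLUB_hullSup hE _)⟩
  rintro _ ⟨e, he, rfl⟩
  exact hmax e he

end GEA

/-! ### Passing between the algebra and a direct summand. -/

namespace GEX

open GEA

variable {E : Type u} [GEA E] {π : GEX E}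

namespace Summand

theorem isSum_iff {x y z : π.Summand} : IsSum x y z ↔ IsSum x.val y.val z.val := Iff.rfl

theorem val_mk (e : E) (h : π e = e) : (mk e h).val = e := rfl

theorem val_eq_zero {x : π.Summand} : x.val = 0 ↔ x = 0 :=
  ⟨fun h => val_injective h, fun h => h ▸ rfl⟩

theorem le_iff_val {x y : π.Summand} : x ≤ y ↔ x.val ≤ y.val := by
  constructor
  · rintro ⟨d, hd⟩
    exact ⟨d.val, hd⟩
  · rintro ⟨d, hd⟩
    exact ⟨mk d (π.apply_of_le (apply_val y) hd.le_right), hd⟩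

theorem orth_iff_val {x y : π.Summand} : Orth x y ↔ Orth x.val y.val := by
  constructor
  · rintro ⟨z, hz⟩
    exact ⟨z.val, hz⟩
  · rintro ⟨z, hz⟩
    exact ⟨mk z (π.apply_eq_self_of_isSum hz (apply_val x) (apply_val y)), hz⟩

theorem isFinSum_val {I : Type v} {x : I → π.Summand} {J : Finset I} {s : π.Summand}
    (h : IsFinSum x J s) : IsFinSum (fun i => (x i).val) J s.val := by
  induction h with
  | empty => exact .empty
  | cons hi _ hst ih => exact ih.cons hi hst

theorem exists_isFinSum {I : Type v} {x : I → π.Summand} {J : Finset I} {t : E}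
    (h : IsFinSum (fun i => (x i).val) J t) : ∃ s : π.Summand, s.val = t ∧ IsFinSum x J s := by
  induction h with
  | empty => exact ⟨0, rfl, .empty⟩
  | @cons J i hi s t _ hst ih =>
    obtain ⟨s, rfl, hs⟩ := ih
    exact ⟨mk t (π.apply_eq_self_of_isSum hst (apply_val s) (apply_val (x i))), rfl,
      hs.cons hi hst⟩

theorem isOrthogonal_val {I : Type v} {x : I → π.Summand} :
    IsOrthogonal (fun i => (x i).val) ↔ IsOrthogonal x := by
  constructor
  · intro h J
    obtain ⟨t, ht⟩ := h J
    obtain ⟨s, -, hs⟩ := exists_isFinSum ht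
    exact ⟨s, hs⟩
  · intro h J
    obtain ⟨s, hs⟩ := h J
    exact ⟨s.val, isFinSum_val hs⟩

theorem isOrthosum_val {I : Type v} {x : I → π.Summand} {s : π.Summand} :
    IsOrthosum (fun i => (x i).val) s.val ↔ IsOrthosum x s := by
  constructor
  · rintro ⟨ho, hub, hlub⟩
    refine ⟨isOrthogonal_val.1 ho, ?_, fun u hu => le_iff_val.2 (hlub ?_)⟩
    · rintro t ⟨J, hJ⟩
      exact le_iff_val.2 (hub ⟨J, isFinSum_val hJ⟩)
    · rintro t ⟨J, hJ⟩
      obtain ⟨t, rfl, ht⟩ := exists_isFinSum hJ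
      exact le_iff_val.1 (hu ⟨J, ht⟩)
  · rintro ⟨ho, hub, hlub⟩
    refine ⟨isOrthogonal_val.2 ho, ?_, fun u hu => ?_⟩
    · rintro t ⟨J, hJ⟩
      obtain ⟨t, rfl, ht⟩ := exists_isFinSum hJ
      exact le_iff_val.1 (hub ⟨J, ht⟩)
    · have : s ≤ mk (π u) (π.idem u) := hlub <| by
        rintro t ⟨J, hJ⟩
        rw [le_iff_val, ← apply_val t]
        exact π.mono (hu ⟨J, isFinSum_val hJ⟩)
      exact (le_iff_val.1 this).trans (π.decreasing u)

theorem exists_isOrthosum {I : Type v} {x : I → π.Summand} {t : E}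
    (h : IsOrthosum (fun i => (x i).val) t) : ∃ s : π.Summand, s.val = t ∧ IsOrthosum x s := by
  have ht : π t = t := by
    refine le_antisymm (π.decreasing t) (h.2.2 ?_)
    rintro a ⟨J, hJ⟩
    obtain ⟨s, rfl, -⟩ := exists_isFinSum hJ
    rw [← apply_val s]
    exact π.mono (h.2.1 ⟨J, hJ⟩)
  exact ⟨mk t ht, rfl, isOrthosum_val.1 h⟩

end Summand

open Summand

/-- The extension of a mapping in the exocenter of `π(E)` by zero on the complement. -/
def extend (ξ : GEX π.Summand) : GEX E where
  toFun e := (ξ (Summand.mk (π e) (π.idem e))).val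
  map_sum h := ξ.map_sum (isSum_iff.2 (π.map_sum h))
  idem e := by
    have : Summand.mk (π (ξ (Summand.mk (π e) (π.idem e))).val) (π.idem _) =
        ξ (Summand.mk (π e) (π.idem e)) :=
      val_injective (apply_val _)
    rw [this, ξ.idem]
  decreasing e := (le_iff_val.1 (ξ.decreasing _)).trans (π.decreasing e)
  orth {e f} he hf := by
    have hπe : π e = e := he ▸ apply_val (ξ (Summand.mk (π e) (π.idem e)))
    have h₁ : ξ (Summand.mk e hπe) = Summand.mk e hπe := val_injective (by
      have : Summand.mk (π e) (π.idem e) = Summand.mk e hπe := val_injective hπe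
      rwa [this] at he)
    obtain ⟨s, hs⟩ := ξ.orth h₁ (val_injective hf)
    -- `s` is the sum of `e` and πf inside π(E). Adding the remainder π'f and reassociating yields e
    -- ⊕ f.
    obtain ⟨t, ht⟩ := π.orth (apply_val s) (π.apply_compl f)
    obtain ⟨w, hw, hwt⟩ := assoc' (isSum_iff.1 hs) ht
    rw [val_mk] at hw hwt
    rw [isSum_unique hw (π.isSum_apply_compl f)] at hwt
    exact ⟨t, hwt⟩

theorem extend_apply (ξ : GEX π.Summand) (x : π.Summand) : extend ξ x.val = (ξ x).val :=
  congrArg (fun y => (ξ y).val) (val_injective (apply_val x) : Summand.mk (π x.val) (π.idem _) = x)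

theorem apply_eq_self_of_extend {ξ : GEX π.Summand} {e : E} (h : extend ξ e = e) : π e = e := by
  rw [← h]; exact apply_val _

/-- The restriction of a mapping in the exocenter to the direct summand `π(E)`. -/
def onSummand (π ξ : GEX E) : GEX π.Summand where
  toFun x := Summand.mk (ξ x.val) (π.apply_of_le (apply_val x) (ξ.decreasing _))
  map_sum h := ξ.map_sum h
  idem x := val_injective (ξ.idem x.val)
  decreasing x := le_iff_val.2 (ξ.decreasing x.val)
  orth he hf := orth_iff_val.2 (ξ.orth (congrArg val he) (congrArg val hf))

theorem onSummand_eq_self {ξ : GEX E} {x : π.Summand} :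
    onSummand π ξ x = x ↔ ξ x.val = x.val :=
  ⟨fun h => congrArg val h, fun h => val_injective h⟩

theorem onSummand_eq_zero {ξ : GEX E} {x : π.Summand} :
    onSummand π ξ x = 0 ↔ ξ x.val = 0 :=
  ⟨fun h => congrArg val h, fun h => val_injective h⟩

end GEX

namespace GEA

open GEX GEX.Summand

variable {E : Type u} [GEA E] {sim : E → E → Prop} {π : GEX E}

theorem related_restrict {x y : π.Summand} :
    Related (π.restrict sim) x y ↔ Related sim x.val y.val := by
  constructor
  · rintro ⟨a, b, ha, hb, hax, hab, hby⟩
    exact ⟨a.val, b.val, fun h => ha (val_eq_zero.1 h), fun h => hb (val_eq_zero.1 h),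
      le_iff_val.1 hax, hab, le_iff_val.1 hby⟩
  · rintro ⟨a, b, ha, hb, hax, hab, hby⟩
    exact ⟨Summand.mk a (π.apply_of_le (apply_val x) hax),
      Summand.mk b (π.apply_of_le (apply_val y) hby),
      fun h => ha (congrArg val h), fun h => hb (congrArg val h), le_iff_val.2 hax, hab,
      le_iff_val.2 hby⟩

/-- Extension by zero keeps exocentral mappings disjoint, so a family orthogonal in this sense in
π(E) is so in `E`. -/
theorem isCentrallyOrthocomplete_summand (hE : IsCentrallyOrthocomplete E) :
    IsCentrallyOrthocomplete π.Summand := by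
  have key : ∀ (I : Type u) (x : I → π.Summand), IsGEXOrthogonal x →
      IsGEXOrthogonal fun i => (x i).val := by
    rintro I x ⟨p, hp, hpx⟩
    refine ⟨fun i => extend (p i), fun i j hij => ?_, fun i => ?_⟩
    · ext e
      change extend (p i) (p j (Summand.mk (π e) (π.idem e))).val = 0
      rw [extend_apply, ← inf_apply, hp hij]
      rfl
    · rw [extend_apply, hpx i]
  refine ⟨fun I x hx => ?_, fun I x s f hx hs hf => ?_⟩
  · obtain ⟨t, ht⟩ := hE.summable I _ (key I x hx)
    obtain ⟨s, -, hs⟩ := exists_isOrthosum ht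
    exact ⟨s, hs⟩
  · exact orth_iff_val.2 (hE.orth_sum I _ _ _ (key I x hx) (isOrthosum_val.2 hs)
      fun i => orth_iff_val.1 (hf i))

theorem isDedekindOrthocomplete_summand (hE : IsDedekindOrthocomplete E) :
    IsDedekindOrthocomplete π.Summand := by
  rintro I x hx ⟨u, hu⟩
  obtain ⟨t, ht⟩ := hE I _ (isOrthogonal_val.2 hx) ⟨u.val, by
    rintro t ⟨J, hJ⟩
    obtain ⟨t, rfl, ht⟩ := exists_isFinSum hJ
    exact le_iff_val.1 (hu ⟨J, ht⟩)⟩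
  obtain ⟨s, -, hs⟩ := exists_isOrthosum ht
  exact ⟨s, hs⟩

theorem onSummand_mem_splitting {ξ : GEX E} (hξ : ξ ∈ splitting sim) :
    onSummand π ξ ∈ splitting (π.restrict sim) := by
  rw [mem_splitting] at hξ ⊢
  intro e f he hf hef
  obtain ⟨h₁, h₂⟩ := hξ e.val f.val (onSummand_eq_self.1 he) (onSummand_eq_zero.1 hf) hef
  exact ⟨val_eq_zero.1 h₁, val_eq_zero.1 h₂⟩

theorem extend_mem_splitting (h : IsSKCongruence sim) (hπ : π ∈ splitting sim)
    {ξ : GEX π.Summand} (hξ : ξ ∈ splitting (π.restrict sim)) : extend ξ ∈ splitting sim := by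
  rw [mem_splitting] at hξ ⊢
  intro e f he hf hef
  have hπe := apply_eq_self_of_extend he
  have hπf := apply_eq_self_of_sim h hπ hef hπe
  have h₁ := extend_apply ξ (Summand.mk e hπe)
  have h₂ := extend_apply ξ (Summand.mk f hπf)
  rw [val_mk] at h₁ h₂
  obtain ⟨h₃, h₄⟩ := hξ (Summand.mk e hπe) (Summand.mk f hπf) (val_injective (h₁.symm.trans he))
    (val_injective (h₂.symm.trans hf)) hef
  exact ⟨congrArg val h₃, congrArg val h₄⟩

theorem isDGEA_summand (hE : IsDGEA sim) (hπ : π ∈ splitting sim) :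
    IsDGEA (π.restrict sim) where
  centrallyOrthocomplete := isCentrallyOrthocomplete_summand hE.centrallyOrthocomplete
  dedekindOrthocomplete := isDedekindOrthocomplete_summand hE.dedekindOrthocomplete
  der := by
    have h := hE.der.toIsSKCongruence
    have hle : ∀ (x : π.Summand) (e : E), e ≤ x.val → π e = e := fun x e he =>
      π.apply_of_le (apply_val x) he
    refine { equivalence := ⟨fun x => h.equivalence.refl x.val, h.equivalence.symm,
               h.equivalence.trans⟩, sk1 := ?_, sk2 := ?_, sk3d := ?_, sk3e := ?_, sk4a := ?_,
             sk4b := ?_, sk4a' := ?_ }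
    · exact fun e he => val_eq_zero.1 (h.sk1 _ he)
    · exact fun I e f s t hs ht hef =>
        h.sk2 I _ _ _ _ (isOrthosum_val.2 hs) (isOrthosum_val.2 ht) hef
    · intro p s t r hr hp
      obtain ⟨e, f, hef, he, hf⟩ := h.sk3d _ _ _ _ (isSum_iff.1 hr) hp
      exact ⟨Summand.mk e (hle p e hef.le), Summand.mk f (hle p f hef.le_right), hef, he, hf⟩
    · intro e f s t r hef hst
      obtain ⟨e₁, e₂, f₁, f₂, a, b, he, hf, ha, hsa, hb, htb⟩ :=
        h.sk3e _ _ _ _ _ (isSum_iff.1 hef) (isSum_iff.1 hst)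
      have he₁ := hle e e₁ he.le
      have he₂ := hle e e₂ he.le_right
      have hf₁ := hle f f₁ hf.le
      have hf₂ := hle f f₂ hf.le_right
      exact ⟨Summand.mk e₁ he₁, Summand.mk e₂ he₂, Summand.mk f₁ hf₁, Summand.mk f₂ hf₂,
        Summand.mk a (π.apply_eq_self_of_isSum ha he₁ hf₁),
        Summand.mk b (π.apply_eq_self_of_isSum hb he₂ hf₂),
        he, hf, ha, hsa, hb, htb⟩
    · intro e f hef
      exact related_restrict.2 (h.sk4a _ _ fun hc => hef (orth_iff_val.2 hc))
    · intro e f hef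
      -- The element `d₁` need not lie below a given element of π(E); it lies in π(E) because `π`
      -- splits ∼.
      obtain ⟨e₁, d₁, he₁, hd₁, hee, hsim, hd⟩ := h.sk4b _ _ fun hc => hef (le_iff_val.2 hc)
      have hπe := hle e e₁ hee
      exact ⟨Summand.mk e₁ hπe, Summand.mk d₁ (apply_eq_self_of_sim h hπ hsim hπe),
        fun h0 => he₁ (congrArg val h0),
        fun h0 => hd₁ (congrArg val h0), le_iff_val.2 hee, hsim, orth_iff_val.2 hd⟩
    · intro e f hef
      obtain ⟨ξ, hξ, he, hf⟩ := hE.der.sk4a' _ _ fun hc => hef (related_restrict.2 hc)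
      refine ⟨onSummand π ξ, onSummand_mem_splitting hξ, ?_, ?_⟩
      · rw [GEX.mem_image] at he ⊢
        exact onSummand_eq_self.2 he
      · rw [GEX.mem_image, GEX.compl_eq_self_iff] at hf ⊢
        exact onSummand_eq_zero.2 hf

/-- Splitting mappings pass from `E` to π(E) by restriction and back by extension, so the smallest
ones fixing `x` correspond; the identity of π(E) corresponds to `π`. -/
theorem isFaithful_restrict (hE : IsDGEA sim) (hπ : π ∈ splitting sim) (x : π.Summand) :
    IsFaithful (π.restrict sim) x ↔ hull sim x.val = π := by
  have h := hE.der.toIsSKCongruence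
  constructor
  · rintro ⟨-, hmin⟩
    refine IsHull.eq_hull hE ⟨⟨hπ, apply_val x⟩, fun ξ ⟨hξ, hξx⟩ e => ?_⟩
    have h₁ := hmin ⟨onSummand_mem_splitting hξ, onSummand_eq_self.2 hξx⟩
      (Summand.mk (π e) (π.idem e))
    rw [comp_comm]
    exact congrArg val h₁
  · intro hx
    refine ⟨⟨top_mem_splitting (isDGEA_summand hE hπ).der.toIsSKCongruence, rfl⟩,
      fun ξ ⟨hξ, hξx⟩ y => val_injective ?_⟩
    have hle := (hull_le_iff hE (extend_mem_splitting h hπ hξ)).2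
      ((extend_apply ξ x).trans (congrArg val hξx))
    rw [hx] at hle
    have := apply_eq_self_of_le hle (apply_val y)
    rwa [extend_apply] at this

theorem mem_simples_restrict {x : π.Summand} :
    x ∈ simples (π.restrict sim) ↔ x.val ∈ simples sim := by
  constructor
  · intro hx e d hed hr
    exact hx (Summand.mk e (π.apply_of_le (apply_val x) hed.le))
      (Summand.mk d (π.apply_of_le (apply_val x) hed.le_right)) hed (related_restrict.2 hr)
  · exact fun hx e d hed hr => hx _ _ (isSum_iff.1 hed) (related_restrict.1 hr)

theorem mem_finites_restrict {x : π.Summand} :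
    x ∈ finites (π.restrict sim) ↔ x.val ∈ finites sim := by
  constructor
  · exact fun hx e he hs => congrArg val
      (hx (Summand.mk e (π.apply_of_le (apply_val x) he)) (le_iff_val.2 he) hs)
  · exact fun hx e he hs => val_injective (hx _ (le_iff_val.1 he) hs)

theorem mem_invariants_restrict (h : IsSKCongruence sim) (hπ : π ∈ splitting sim)
    {x : π.Summand} : x ∈ invariants (π.restrict sim) ↔ x.val ∈ invariants sim := by
  have hle : ∀ e : E, e ≤ x.val → π e = e := fun e he => π.apply_of_le (apply_val x) he
  constructor
  · rintro ⟨hp, hi⟩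
    refine ⟨fun e f g he hf hg => ?_, fun c f hc hs hf => ?_⟩
    · exact le_iff_val.1 (hp (Summand.mk e (hle e he)) (Summand.mk f (hle f hf))
        (Summand.mk g (π.apply_eq_self_of_isSum hg (hle e he) (hle f hf))) (le_iff_val.2 he)
        (le_iff_val.2 hf) hg)
    · obtain ⟨h₁, h₂⟩ := hi (Summand.mk c (hle c hc))
        (Summand.mk f (apply_eq_self_of_sim h hπ hs (hle c hc)))
        (le_iff_val.2 hc) hs (orth_iff_val.2 hf)
      exact ⟨congrArg val h₁, congrArg val h₂⟩
  · rintro ⟨hp, hi⟩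
    refine ⟨fun e f g he hf hg => ?_, fun c f hc hs hf => ?_⟩
    · exact le_iff_val.2 (hp _ _ _ (le_iff_val.1 he) (le_iff_val.1 hf) (isSum_iff.1 hg))
    · obtain ⟨h₁, h₂⟩ := hi _ _ (le_iff_val.1 hc) hs (orth_iff_val.1 hf)
      exact ⟨val_eq_zero.1 h₁, val_eq_zero.1 h₂⟩

theorem exists_faithful_iff (hE : IsDGEA sim) (hπ : π ∈ splitting sim) {T : Set π.Summand}
    {S : Set E} (hTS : ∀ x, x ∈ T ↔ x.val ∈ S) :
    (∃ x ∈ T, IsFaithful (π.restrict sim) x) ↔ ∃ e ∈ S, hull sim e = π := by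
  constructor
  · rintro ⟨x, hx, hf⟩
    exact ⟨x.val, (hTS x).1 hx, (isFaithful_restrict hE hπ x).1 hf⟩
  · rintro ⟨e, he, hh⟩
    have hπe : π e = e := hh ▸ hull_apply_self hE e
    exact ⟨Summand.mk e hπe, (hTS _).2 he, (isFaithful_restrict hE hπ _).2 hh⟩

theorem forall_eq_zero_iff {T : Set π.Summand} {S : Set E} (hTS : ∀ x, x ∈ T ↔ x.val ∈ S) :
    (∀ x ∈ T, x = 0) ↔ ∀ e ∈ S, π e = e → e = 0 := by
  constructor
  · exact fun h e he hπe => congrArg val (h (Summand.mk e hπe) ((hTS _).2 he))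
  · exact fun h x hx => val_eq_zero.1 (h _ ((hTS x).1 hx) (apply_val x))

theorem isTypeI_restrict (hE : IsDGEA sim) (hπ : π ∈ splitting sim) :
    IsTypeI (π.restrict sim) ↔ ∃ k ∈ simples sim, hull sim k = π :=
  exists_faithful_iff hE hπ fun _ => mem_simples_restrict

theorem isTypeII_restrict (hE : IsDGEA sim) (hπ : π ∈ splitting sim) :
    IsTypeII (π.restrict sim) ↔
      (∃ f ∈ finites sim, hull sim f = π) ∧ ∀ k ∈ simples sim, π k = k → k = 0 :=
  and_congr (exists_faithful_iff hE hπ fun _ => mem_finites_restrict)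
    (forall_eq_zero_iff fun _ => mem_simples_restrict)

theorem isTypeIII_restrict :
    IsTypeIII (π.restrict sim) ↔ ∀ f ∈ finites sim, π f = f → f = 0 :=
  forall_eq_zero_iff fun _ => mem_finites_restrict

theorem isFiniteType_restrict (hE : IsDGEA sim) (hπ : π ∈ splitting sim) :
    IsFiniteType (π.restrict sim) ↔ ∃ f ∈ finites sim ∩ invariants sim, hull sim f = π :=
  exists_faithful_iff hE hπ fun _ => and_congr mem_finites_restrict
    (mem_invariants_restrict hE.der.toIsSKCongruence hπ)

theorem isProperlyNonFiniteType_restrict (hE : IsDGEA sim) (hπ : π ∈ splitting sim) :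
    IsProperlyNonFiniteType (π.restrict sim) ↔
      ∀ f ∈ finites sim ∩ invariants sim, π f = f → f = 0 :=
  forall_eq_zero_iff fun _ => and_congr mem_finites_restrict
    (mem_invariants_restrict hE.der.toIsSKCongruence hπ)

theorem isHereditarySummand (hE : IsDGEA sim) (hπ : π ∈ splitting sim) :
    IsHereditarySummand sim π where
  directSummand := by
    refine ⟨πᶜ.image, ?_⟩
    have h := isDirectSum_image (p := ![π, πᶜ]) (π := ⊤) (by
      intro i j hij
      fin_cases i <;> fin_cases j <;> simp_all) (by
      simp [Fin.univ_succ])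
    convert h using 1
    · exact (Set.eq_univ_of_forall fun e => (GEX.mem_image ⊤).2 rfl).symm
    · funext i
      fin_cases i <;> rfl
  hereditary h hh e h₁ hs hle := by
    rw [GEX.mem_image] at hh ⊢
    exact apply_eq_self_of_sim hE.der.toIsSKCongruence hπ (hE.der.equivalence.symm hs)
      (π.apply_of_le hh hle)
  dgea := isDGEA_summand hE hπ

end GEA

/-! ### Types of summands as inequalities in the exocenter. -/

namespace GEA

open GEX GEX.Summand

variable {E : Type u} [GEA E] {sim : E → E → Prop} {π : GEX E}

theorem etaK_mem_splitting (hE : IsDGEA sim) : etaK sim ∈ splitting sim := by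
  obtain ⟨k, -, hk⟩ := exists_simple_hull_eq hE
  exact hk ▸ hull_mem_splitting hE k

theorem etaF_mem_splitting (hE : IsDGEA sim) : etaF sim ∈ splitting sim := by
  obtain ⟨f, -, hf⟩ := exists_finite_hull_eq hE
  exact hf ▸ hull_mem_splitting hE f

theorem hull_le_etaK (hE : IsDGEA sim) {k : E} (hk : k ∈ simples sim) : hull sim k ≤ etaK sim :=
  (isLUB_hullSup hE _).1 ⟨k, hk, rfl⟩

theorem hull_le_etaF (hE : IsDGEA sim) {f : E} (hf : f ∈ finites sim) : hull sim f ≤ etaF sim :=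
  (isLUB_hullSup hE _).1 ⟨f, hf, rfl⟩

theorem hull_le_hull_fTilde (hE : IsDGEA sim) {c : E} (hc : c ∈ finites sim ∩ invariants sim) :
    hull sim c ≤ hull sim (fTilde sim) :=
  hull_mono hE ((isGreatest_fTilde hE).2 hc)

theorem etaK_le_etaF (hE : IsDGEA sim) : etaK sim ≤ etaF sim := by
  obtain ⟨k, hk, h⟩ := exists_simple_hull_eq hE
  exact h ▸ hull_le_etaF hE (simples_subset_finites hE hk)

theorem eq_zero_of_hull_le (hE : IsDGEA sim) {ξ : GEX E} {e : E} (hπ : π ≤ ξᶜ) (he : π e = e)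
    (hξ : hull sim e ≤ ξ) : e = 0 := by
  have h₁ := ξ.compl_eq_self_iff.1 (apply_eq_self_of_le hπ he)
  rwa [apply_eq_self_of_le hξ (hull_apply_self hE e)] at h₁

theorem le_compl_hull (hE : IsDGEA sim) (hπ : π ∈ splitting sim) {e : E} (he : π e = 0) :
    π ≤ (hull sim e)ᶜ := by
  rw [le_compl_comm, hull_le_iff hE (compl_mem_splitting hE.der.toIsSKCongruence hπ)]
  exact π.compl_eq_self_iff.2 he

/-- If `k` is a simple element with hull η_K, then πk is simple with hull π ∧ η_K, which is `π` as
soon as π ≤ η_K. The criteria for the other types cut a finite or finite invariant element in the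
same way. -/
theorem isTypeI_iff_le (hE : IsDGEA sim) (hπ : π ∈ splitting sim) :
    IsTypeI (π.restrict sim) ↔ π ≤ etaK sim := by
  rw [isTypeI_restrict hE hπ]
  constructor
  · rintro ⟨k, hk, rfl⟩
    exact hull_le_etaK hE hk
  · intro h
    obtain ⟨k, hk, hK⟩ := exists_simple_hull_eq hE
    exact ⟨π k, mem_simples_of_le hk (π.decreasing k),
      by rw [hull_apply hE hπ, hK, inf_eq_left.2 h]⟩

theorem isTypeII_iff_le (hE : IsDGEA sim) (hπ : π ∈ splitting sim) :
    IsTypeII (π.restrict sim) ↔ π ≤ etaF sim ⊓ (etaK sim)ᶜ := by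
  rw [isTypeII_restrict hE hπ, le_inf_iff]
  refine and_congr ⟨?_, fun h => ?_⟩ ⟨fun h => ?_, fun h k hk hπk => ?_⟩
  · rintro ⟨f, hf, rfl⟩
    exact hull_le_etaF hE hf
  · obtain ⟨f, hf, hF⟩ := exists_finite_hull_eq hE
    exact ⟨π f, mem_finites_of_le hE hf (π.decreasing f),
      by rw [hull_apply hE hπ, hF, inf_eq_left.2 h]⟩
  · obtain ⟨k, hk, hK⟩ := exists_simple_hull_eq hE
    rw [← hK]
    exact le_compl_hull hE hπ (h _ (mem_simples_of_le hk (π.decreasing k)) (π.idem k))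
  · exact eq_zero_of_hull_le hE h hπk (hull_le_etaK hE hk)

theorem isTypeIII_iff_le (hE : IsDGEA sim) (hπ : π ∈ splitting sim) :
    IsTypeIII (π.restrict sim) ↔ π ≤ (etaF sim)ᶜ := by
  rw [isTypeIII_restrict]
  refine ⟨fun h => ?_, fun h f hf hπf => eq_zero_of_hull_le hE h hπf (hull_le_etaF hE hf)⟩
  obtain ⟨f, hf, hF⟩ := exists_finite_hull_eq hE
  rw [← hF]
  exact le_compl_hull hE hπ (h _ (mem_finites_of_le hE hf (π.decreasing f)) (π.idem f))

theorem apply_fTilde_mem (hE : IsDGEA sim) (hπ : π ∈ splitting sim) :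
    π (fTilde sim) ∈ finites sim ∩ invariants sim :=
  ⟨mem_finites_of_le hE (isGreatest_fTilde hE).1.1 (π.decreasing _),
    apply_mem_invariants hE (isGreatest_fTilde hE).1.2 hπ⟩

theorem isFiniteType_iff_le (hE : IsDGEA sim) (hπ : π ∈ splitting sim) :
    IsFiniteType (π.restrict sim) ↔ π ≤ hull sim (fTilde sim) := by
  rw [isFiniteType_restrict hE hπ]
  constructor
  · rintro ⟨c, hc, rfl⟩
    exact hull_le_hull_fTilde hE hc
  · exact fun h => ⟨_, apply_fTilde_mem hE hπ, by rw [hull_apply hE hπ, inf_eq_left.2 h]⟩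

theorem isProperlyNonFiniteType_iff_le (hE : IsDGEA sim) (hπ : π ∈ splitting sim) :
    IsProperlyNonFiniteType (π.restrict sim) ↔ π ≤ (hull sim (fTilde sim))ᶜ := by
  rw [isProperlyNonFiniteType_restrict hE hπ]
  exact ⟨fun h => le_compl_hull hE hπ (h _ (apply_fTilde_mem hE hπ) (π.idem _)),
    fun h c hc hπc => eq_zero_of_hull_le hE h hπc (hull_le_hull_fTilde hE hc)⟩

theorem mem_etaExocenter_of_le (hE : IsDGEA sim) (hπ : π ∈ splitting sim) (h : π ≤ etaF sim) :
    π ∈ etaExocenter sim := by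
  obtain ⟨f, -, hF⟩ := exists_finite_hull_eq hE
  refine ⟨π f, ?_⟩
  have := isHull_hull hE (π f)
  rwa [hull_apply hE hπ, hF, inf_eq_left.2 h] at this

/-- The invariant element f̃ is the top of the range of its hull, so πf̃ is the top of π(E). -/
theorem exists_unit_of_le (hE : IsDGEA sim) (h : π ≤ hull sim (fTilde sim)) :
    ∃ v : π.Summand, v.val = π (fTilde sim) ∧ IsEffectAlgebraWithUnit v := by
  refine ⟨Summand.mk _ (π.idem _), rfl, fun x => le_iff_val.2 ?_⟩
  rw [← apply_val x]
  exact π.mono ((mem_invariants_iff hE).1 (isGreatest_fTilde hE).1.2 _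
    (apply_eq_self_of_le h (apply_val x)))

theorem isDirectSum_image_pair {ξ ρ : GEX E} (hd : π ⊓ ξ = ⊥) (hs : π ⊔ ξ = ρ) :
    IsDirectSum ρ.image ![π.image, ξ.image] := by
  have h := isDirectSum_image (p := ![π, ξ]) (π := ρ) (by
    intro i j hij
    fin_cases i <;> fin_cases j <;> simp_all [inf_comm]) (by
    simpa [Fin.univ_succ] using hs)
  convert h using 1
  funext i
  fin_cases i <;> rfl

theorem image_top : (⊤ : GEX E).image = Set.univ :=
  Set.eq_univ_of_forall fun _ => (GEX.mem_image ⊤).2 rfl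

theorem isDirectSum_univ_triple {ξ ρ : GEX E} (h₁ : π ⊓ ξ = ⊥) (h₂ : π ⊓ ρ = ⊥) (h₃ : ξ ⊓ ρ = ⊥)
    (hs : π ⊔ ξ ⊔ ρ = ⊤) : IsDirectSum Set.univ ![π.image, ξ.image, ρ.image] := by
  have h := isDirectSum_image (p := ![π, ξ, ρ]) (π := ⊤) (by
    intro i j hij
    fin_cases i <;> fin_cases j <;> simp_all [inf_comm]) (by
    simpa [Fin.univ_succ, sup_assoc] using hs)
  rw [image_top] at h
  convert h using 1
  funext i
  fin_cases i <;> rfl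

end GEA

/-! ### Lattice computations and the decomposition theorem. -/

theorem isLUB_triple_iff {α : Type u} [SemilatticeSup α] {a b c d : α} :
    IsLUB {a, b, c} d ↔ a ⊔ b ⊔ c = d := by
  have h : IsLUB {a, b, c} (a ⊔ b ⊔ c) := by
    rw [sup_assoc]
    exact isLUB_pair.insert a
  exact ⟨fun hd => h.unique hd, fun hd => hd ▸ h⟩

theorem isLUB_pair_iff {α : Type u} [SemilatticeSup α] {a b d : α} :
    IsLUB {a, b} d ↔ a ⊔ b = d :=
  ⟨fun hd => isLUB_pair.unique hd, fun hd => hd ▸ isLUB_pair⟩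

/-- The uniqueness principle: `a` is covered by x ∨ y but meets `y` trivially, so it lies below `x`.
-/
theorem eq_of_le_of_sup_le {α : Type u} [DistribLattice α] [OrderBot α] {a b x y : α}
    (hx : x ≤ a) (hy : y ≤ b) (hab : a ⊓ b = ⊥) (h : a ⊔ b ≤ x ⊔ y) : x = a := by
  refine le_antisymm hx ?_
  calc a ≤ a ⊓ (x ⊔ y) := le_inf le_rfl (le_sup_left.trans h)
    _ = a ⊓ x ⊔ a ⊓ y := inf_sup_left _ _ _
    _ ≤ x := sup_le inf_le_right (((inf_le_inf_left a hy).trans hab.le).trans bot_le)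

theorem inf_sup_inf_compl_self {α : Type u} [BooleanAlgebra α] (a b : α) :
    a ⊓ b ⊔ a ⊓ bᶜ = a := by
  rw [← inf_sup_left, sup_compl_eq_top, inf_top_eq]

theorem inf_inf_inf_compl_self {α : Type u} [BooleanAlgebra α] (a b : α) :
    a ⊓ b ⊓ (a ⊓ bᶜ) = ⊥ := by
  rw [← inf_inf_distrib_left, inf_compl_self, inf_bot_eq]

end

open GEA in
theorem mainTheorem1 {E : Type u} [GEA E] (sim : E → E → Prop) (hE : IsDGEA sim) :
    -- the hull system, `η_K`, `η_F` and the largest finite invariant element exist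
    (∀ e : E, IsHull sim e (hull sim e)) ∧
    IsLUB (hull sim '' simples sim) (etaK sim) ∧
    IsLUB (hull sim '' finites sim) (etaF sim) ∧
    IsGreatest (finites sim ∩ invariants sim) (fTilde sim) ∧
    ∃ πI πII πIII : GEX E,
      -- the decomposition into types I, II, III
      (πI ∈ splitting sim ∧ πII ∈ splitting sim ∧ πIII ∈ splitting sim) ∧
      (πI ⊓ πII = ⊥ ∧ πI ⊓ πIII = ⊥ ∧ πII ⊓ πIII = ⊥) ∧
      IsLUB {πI, πII, πIII} ⊤ ∧
      IsDirectSum Set.univ ![πI.image, πII.image, πIII.image] ∧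
      (IsHereditarySummand sim πI ∧ IsTypeI (πI.restrict sim)) ∧
      (IsHereditarySummand sim πII ∧ IsTypeII (πII.restrict sim)) ∧
      (IsHereditarySummand sim πIII ∧ IsTypeIII (πIII.restrict sim)) ∧
      -- uniqueness
      (∀ ρI ρII ρIII : GEX E,
        ρI ∈ splitting sim → ρII ∈ splitting sim → ρIII ∈ splitting sim →
        IsLUB {ρI, ρII, ρIII} ⊤ →
        IsTypeI (ρI.restrict sim) → IsTypeII (ρII.restrict sim) → IsTypeIII (ρIII.restrict sim) →
        ρI = πI ∧ ρII = πII ∧ ρIII = πIII) ∧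
      (πI = etaK sim ∧ πI ∈ etaExocenter sim) ∧
      (πII = etaF sim ⊓ (etaK sim)ᶜ ∧ πII ∈ etaExocenter sim) ∧
      πIII = (etaF sim)ᶜ ∧
      -- the further decomposition of the type I and type II parts
      ∃ πIF πINF πIIF πIINF : GEX E,
        (πIF ∈ splitting sim ∧ πINF ∈ splitting sim ∧
          πIIF ∈ splitting sim ∧ πIINF ∈ splitting sim) ∧
        (πIF ⊓ πINF = ⊥ ∧ πIF ⊓ πIIF = ⊥ ∧ πIF ⊓ πIINF = ⊥ ∧
          πINF ⊓ πIIF = ⊥ ∧ πINF ⊓ πIINF = ⊥ ∧ πIIF ⊓ πIINF = ⊥) ∧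
        IsLUB {πIF, πINF} πI ∧
        IsLUB {πIIF, πIINF} πII ∧
        IsDirectSum πI.image ![πIF.image, πINF.image] ∧
        IsDirectSum πII.image ![πIIF.image, πIINF.image] ∧
        (IsHereditarySummand sim πIF ∧ IsTypeIF (πIF.restrict sim)) ∧
        (IsHereditarySummand sim πINF ∧ IsTypeINF (πINF.restrict sim)) ∧
        (IsHereditarySummand sim πIIF ∧ IsTypeIIF (πIIF.restrict sim)) ∧
        (IsHereditarySummand sim πIINF ∧ IsTypeIINF (πIINF.restrict sim)) ∧
        -- uniqueness
        (∀ ρIF ρINF ρIIF ρIINF : GEX E,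
          ρIF ∈ splitting sim → ρINF ∈ splitting sim →
          ρIIF ∈ splitting sim → ρIINF ∈ splitting sim →
          IsLUB {ρIF, ρINF} πI → IsLUB {ρIIF, ρIINF} πII →
          IsTypeIF (ρIF.restrict sim) → IsTypeINF (ρINF.restrict sim) →
          IsTypeIIF (ρIIF.restrict sim) → IsTypeIINF (ρIINF.restrict sim) →
          ρIF = πIF ∧ ρINF = πINF ∧ ρIIF = πIIF ∧ ρIINF = πIINF) ∧
        (πIF = etaK sim ⊓ hull sim (fTilde sim) ∧ πIF ∈ etaExocenter sim) ∧
        (πINF = etaK sim ⊓ (hull sim (fTilde sim))ᶜ ∧ πINF ∈ etaExocenter sim) ∧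
        (πIIF = etaF sim ⊓ (etaK sim)ᶜ ⊓ hull sim (fTilde sim) ∧ πIIF ∈ etaExocenter sim) ∧
        (πIINF = etaF sim ⊓ (etaK sim)ᶜ ⊓ (hull sim (fTilde sim))ᶜ ∧
          πIINF ∈ etaExocenter sim) ∧
        -- the summands of finite type are effect algebras
        (∃ v : πIF.Summand, v.val = etaK sim (fTilde sim) ∧ IsEffectAlgebraWithUnit v) ∧
        (∃ v : πIIF.Summand, v.val = (etaK sim)ᶜ (fTilde sim) ∧ IsEffectAlgebraWithUnit v) := by
  let _ : BooleanAlgebra (GEX E) := GEX.booleanAlgebra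
  have h := hE.der.toIsSKCongruence
  refine ⟨isHull_hull hE, isLUB_hullSup hE _, isLUB_hullSup hE _, isGreatest_fTilde hE, ?_⟩
  have hKs := etaK_mem_splitting hE
  have hFs := etaF_mem_splitting hE
  have hTs := hull_mem_splitting hE (fTilde sim)
  have hKF := etaK_le_etaF hE
  have hTF : hull sim (fTilde sim) ≤ etaF sim := hull_le_etaF hE (isGreatest_fTilde hE).1.1
  -- Since f̃ is finite, η_f̃ ≤ η_F. The factor η_F therefore has no effect on f̃, and the unit
  -- takes the form given in the statement.
  have hIIK : (etaK sim)ᶜ (fTilde sim) = (etaF sim ⊓ (etaK sim)ᶜ ⊓ hull sim (fTilde sim))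
      (fTilde sim) := by
    rw [inf_right_comm, inf_eq_right.2 hTF, inf_comm, GEX.inf_apply, hull_apply_self hE]
  have hIK : etaK sim (fTilde sim) = (etaK sim ⊓ hull sim (fTilde sim)) (fTilde sim) := by
    rw [GEX.inf_apply, hull_apply_self hE]
  have hI := fun {π : GEX E} (hπ : π ∈ splitting sim) => isTypeI_iff_le hE hπ
  have hII := fun {π : GEX E} (hπ : π ∈ splitting sim) => isTypeII_iff_le hE hπ
  have hIII := fun {π : GEX E} (hπ : π ∈ splitting sim) => isTypeIII_iff_le hE hπ
  have hfin := fun {π : GEX E} (hπ : π ∈ splitting sim) => isFiniteType_iff_le hE hπ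
  have hnfin := fun {π : GEX E} (hπ : π ∈ splitting sim) => isProperlyNonFiniteType_iff_le hE hπ
  have hmem := fun {π : GEX E} (hπ : π ∈ splitting sim) => mem_etaExocenter_of_le hE hπ
  have hunit := fun {π : GEX E} => exists_unit_of_le (π := π) hE
  -- The types are now encoded as inequalities, so only Boolean algebra and closure of Σ_∼ remain,
  -- and the three mappings may be treated as abstract elements.
  generalize etaK sim = κ at *
  generalize etaF sim = φ at *
  generalize hull sim (fTilde sim) = τ at *
  have hcompl := fun {π : GEX E} (hπ : π ∈ splitting sim) => compl_mem_splitting h hπ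
  have hinf := fun {π ξ : GEX E} (hπ : π ∈ splitting sim) (hξ : ξ ∈ splitting sim) =>
    inf_mem_splitting h hπ hξ
  have hsum := fun {π : GEX E} (hπ : π ∈ splitting sim) => isHereditarySummand hE hπ
  have hIIs := hinf hFs (hcompl hKs)
  have hIIIs := hcompl hFs
  have hIFs := hinf hKs hTs
  have hINFs := hinf hKs (hcompl hTs)
  have hIIFs := hinf hIIs hTs
  have hIINFs := hinf hIIs (hcompl hTs)
  have hd₁₂ : Disjoint κ (φ ⊓ κᶜ) := disjoint_compl_right.mono_right inf_le_right
  have hd₁₃ : Disjoint κ φᶜ := disjoint_compl_right.mono_left hKF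
  have hd₂₃ : Disjoint (φ ⊓ κᶜ) φᶜ := disjoint_compl_right.mono_left inf_le_left
  have hsup : κ ⊔ φ ⊓ κᶜ ⊔ φᶜ = ⊤ := by
    rw [sup_inf_left, sup_compl_eq_top, inf_top_eq, sup_eq_right.2 hKF, sup_compl_eq_top]
  refine ⟨κ, φ ⊓ κᶜ, φᶜ, ⟨hKs, hIIs, hIIIs⟩,
    ⟨disjoint_iff.1 hd₁₂, disjoint_iff.1 hd₁₃, disjoint_iff.1 hd₂₃⟩, isLUB_triple_iff.2 hsup,
    isDirectSum_univ_triple (disjoint_iff.1 hd₁₂) (disjoint_iff.1 hd₁₃) (disjoint_iff.1 hd₂₃) hsup,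
    ⟨hsum hKs, (hI hKs).2 le_rfl⟩, ⟨hsum hIIs, (hII hIIs).2 le_rfl⟩,
    ⟨hsum hIIIs, (hIII hIIIs).2 le_rfl⟩, ?_, ⟨rfl, hmem hKs hKF⟩, ⟨rfl, hmem hIIs inf_le_left⟩,
    rfl, κ ⊓ τ, κ ⊓ τᶜ, φ ⊓ κᶜ ⊓ τ, φ ⊓ κᶜ ⊓ τᶜ, ⟨hIFs, hINFs, hIIFs, hIINFs⟩,
    ⟨inf_inf_inf_compl_self _ _, disjoint_iff.1 (hd₁₂.mono inf_le_left inf_le_left),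
      disjoint_iff.1 (hd₁₂.mono inf_le_left inf_le_left),
      disjoint_iff.1 (hd₁₂.mono inf_le_left inf_le_left),
      disjoint_iff.1 (hd₁₂.mono inf_le_left inf_le_left), inf_inf_inf_compl_self _ _⟩,
    isLUB_pair_iff.2 (inf_sup_inf_compl_self _ _), isLUB_pair_iff.2 (inf_sup_inf_compl_self _ _),
    isDirectSum_image_pair (inf_inf_inf_compl_self _ _) (inf_sup_inf_compl_self _ _),
    isDirectSum_image_pair (inf_inf_inf_compl_self _ _) (inf_sup_inf_compl_self _ _),
    ⟨hsum hIFs, (hI hIFs).2 inf_le_left, (hfin hIFs).2 inf_le_right⟩,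
    ⟨hsum hINFs, (hI hINFs).2 inf_le_left, (hnfin hINFs).2 inf_le_right⟩,
    ⟨hsum hIIFs, (hII hIIFs).2 inf_le_left, (hfin hIIFs).2 inf_le_right⟩,
    ⟨hsum hIINFs, (hII hIINFs).2 inf_le_left, (hnfin hIINFs).2 inf_le_right⟩, ?_,
    ⟨rfl, hmem hIFs (inf_le_left.trans hKF)⟩, ⟨rfl, hmem hINFs (inf_le_left.trans hKF)⟩,
    ⟨rfl, hmem hIIFs (inf_le_left.trans inf_le_left)⟩,
    ⟨rfl, hmem hIINFs (inf_le_left.trans inf_le_left)⟩, ?_, ?_⟩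
  · intro ρ₁ ρ₂ ρ₃ hs₁ hs₂ hs₃ hlub h₁ h₂ h₃
    rw [isLUB_triple_iff] at hlub
    rw [hI hs₁] at h₁
    rw [hII hs₂] at h₂
    rw [hIII hs₃] at h₃
    refine ⟨eq_of_le_of_sup_le h₁ (sup_le_sup h₂ h₃) ?_ ?_,
      eq_of_le_of_sup_le h₂ (sup_le_sup h₁ h₃) ?_ ?_,
      eq_of_le_of_sup_le h₃ (sup_le_sup h₁ h₂) ?_ ?_⟩
    · exact disjoint_iff.1 (hd₁₂.sup_right hd₁₃)
    · rw [← sup_assoc ρ₁, hlub]; exact le_top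
    · exact disjoint_iff.1 (hd₁₂.symm.sup_right hd₂₃)
    · rw [sup_left_comm ρ₂, ← sup_assoc ρ₁, hlub]; exact le_top
    · exact disjoint_iff.1 (hd₁₃.symm.sup_right hd₂₃.symm)
    · rw [sup_comm ρ₃, hlub]; exact le_top
  · intro ρ₁ ρ₂ ρ₃ ρ₄ hs₁ hs₂ hs₃ hs₄ hlub₁ hlub₂ h₁ h₂ h₃ h₄
    -- Finiteness alone determines the two pieces of a given `ξ`; the type I and type II conditions
    -- are not needed because the joins are prescribed.
    have key : ∀ {ξ a b : GEX E}, a ∈ splitting sim → b ∈ splitting sim → IsLUB {a, b} ξ →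
        IsFiniteType (a.restrict sim) → IsProperlyNonFiniteType (b.restrict sim) →
        a = ξ ⊓ τ ∧ b = ξ ⊓ τᶜ := by
      intro ξ a b ha hb hlub hfa hfb
      have ha' : a ≤ ξ ⊓ τ := le_inf (hlub.1 (by simp)) ((hfin ha).1 hfa)
      have hb' : b ≤ ξ ⊓ τᶜ := le_inf (hlub.1 (by simp)) ((hnfin hb).1 hfb)
      have hξ := isLUB_pair_iff.1 hlub
      refine ⟨eq_of_le_of_sup_le ha' hb' (inf_inf_inf_compl_self _ _) ?_,
        eq_of_le_of_sup_le hb' ha' ?_ ?_⟩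
      · rw [inf_sup_inf_compl_self, hξ]
      · rw [inf_comm, inf_inf_inf_compl_self]
      · rw [sup_comm, inf_sup_inf_compl_self, sup_comm, hξ]
    obtain ⟨e₁, e₂⟩ := key hs₁ hs₂ hlub₁ h₁.2 h₂.2
    obtain ⟨e₃, e₄⟩ := key hs₃ hs₄ hlub₂ h₃.2 h₄.2
    exact ⟨e₁, e₂, e₃, e₄⟩
  · rw [hIK]
    exact hunit inf_le_right
  · rw [hIIK]
    exact hunit inf_le_right
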